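/- Let $(X,d)$ be a nonempty, separable, complete, connected metric space and let $\mu$ be a Borel regular (outer) measure on $X$ that is doubling: there is a constant $C_\mu>0$ with $0<\mu(B(x,r))<\infty$ and $\mu(B(x,2r))\le C_\mu\,\mu(B(x,r))$ for all open balls $B(x,r)$, $x\in X$, $r>0$. Let $0<s<1$ and let $\Omega\subset X$ be a nonempty open set. "Measurable" means $\mu$-measurable. For $x,y\in X$ let $B_{x,y}:=B(x,d(x,y))\cup B(y,d(x,y))$. For open $U\subset X$ and a measurable function $u:U\to[-\infty,\infty]$ put $$\|u\|_{\dot W^{s,1}(U)}:=\int_U\int_U\frac{|u(x)-u(y)|}{\mu(B_{x,y})\,d(x,y)^s}\,d\mu(x)\,d\mu(y),$$ where $|u(x)-u(y)|:=\infty$ if $u(x)$ or $u(y)$ is infinite, and $0/0:=0$ at $x=y$. Write $u\in\dot W^{s,1}(U)$ if this is finite, and $u\in W^{s,1}(U)$ if $\|u\|_{L^1(U)}+\|u\|_{\dot W^{s,1}(U)}<\infty$. Let $W^{s,1}_0(\Omega)$ be the set of all $\eta\in W^{s,1}(X)$ with $\eta=0$ a.e. on $\Omega^c:=X\setminus\Omega$.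 For measurable $u,v:X\to[-\infty,\infty]$ put $$F(u,v):=\left(\int_\Omega\int_\Omega+2\int_\Omega\int_{\Omega^c}\right)\frac{|u(x)-u(y)|-|v(x)-v(y)|}{\mu(B_{x,y})\,d(x,y)^s}\,d\mu(x)\,d\mu(y),$$ where $\infty-\infty:=0$ in the numerator. A measurable function $u:X\to[-\infty,\infty]$ is an $s$-superminimizer (respectively $s$-subminimizer) in $\Omega$ if $u\in\dot W^{s,1}(\Omega)$ and $F(u,u+\eta)\le0$ for every nonnegative (respectively nonpositive) $\eta\in W^{s,1}_0(\Omega)$; for such $u$ and $\eta$ the integral $F(u,u+\eta)$ converges absolutely. For $u:X\to[-\infty,\infty]$ and $x\in X$ define the lower and upper approximate limits, with values in $[-\infty,\infty]$, $$u^\wedge(x):=\sup\left\{t\in\mathbb R:\lim_{r\to0^+}\frac{\mu(\{y\in B(x,r):u(y)<t\})}{\mu(B(x,r))}=0\right\},$$ $$u^\vee(x):=\inf\left\{t\in\mathbb R:\lim_{r\to0^+}\frac{\mu(\{y\in B(x,r):u(y)>t\})}{\mu(B(x,r))}=0\right\}.$$ Then for every $s$-superminimizer $u$ in $\Omega$ the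 function $u^\wedge$ is lower semicontinuous on $\Omega$, and for every $s$-subminimizer $u$ in $\Omega$ the function $u^\vee$ is upper semicontinuous on $\Omega$. -/

import Mathlib

open MeasureTheory Metric Set Filter Topology
open scoped ENNReal NNReal

noncomputable section

namespace NonlocalMin

/-- `μ` is a doubling measure: balls have positive finite measure, and for some constant `C`
one has `μ (B(x,2r)) ≤ C μ (B(x,r))` for all open balls `B(x,r)`, `r > 0`. -/
def IsDoubling {X : Type*} [MetricSpace X] [MeasurableSpace X] (μ : Measure X) : Prop :=
  ∃ C : ℝ≥0, ∀ (x : X) (r : ℝ), 0 < r →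
    0 < μ (ball x r) ∧ μ (ball x r) < ∞ ∧ μ (ball x (2 * r)) ≤ C * μ (ball x r)

variable {X : Type*} [MetricSpace X] [MeasurableSpace X]

/-- The weight `μ(B_{x,y}) d(x,y)^s`, where `B_{x,y} = B(x,d(x,y)) ∪ B(y,d(y,x))`. -/
def weight (μ : Measure X) (s : ℝ) (x y : X) : ℝ≥0∞ :=
  μ (ball x (dist x y) ∪ ball y (dist y x)) * edist x y ^ s

/-- `|u(x) - u(y)|` in `[0,∞]` for an extended real function `u`. If `u(x)` or `u(y)` is infinite,
the value is `∞`, also when both are infinite of the same sign. -/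
def absDiff (u : X → EReal) (x y : X) : ℝ≥0∞ := (u x - u y).abs

/-- The seminorm `∫_Ω ∫_Ω |u(x) - u(y)| / (μ(B_{x,y}) d(x,y)^s) dμ(x) dμ(y)`. -/
def seminorm (μ : Measure X) (s : ℝ) (Ω : Set X) (u : X → EReal) : ℝ≥0∞ :=
  ∫⁻ y in Ω, ∫⁻ x in Ω, absDiff u x y / weight μ s x y ∂μ ∂μ

/-- The homogeneous space of measurable functions on `Ω` with finite seminorm. Measurability is
with respect to the completion of `μ`; only the values of `u` on `Ω` matter. -/
def MemHomogW (μ : Measure X) (s : ℝ) (Ω : Set X) (u : X → EReal) : Prop :=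
  AEMeasurable u (μ.restrict Ω) ∧ seminorm μ s Ω u < ∞

/-- The space `W^{s,1}(Ω)`: the sum of the `L¹(Ω)` norm and of the seminorm is finite. -/
def MemW (μ : Measure X) (s : ℝ) (Ω : Set X) (u : X → EReal) : Prop :=
  AEMeasurable u (μ.restrict Ω) ∧ (∫⁻ x in Ω, (u x).abs ∂μ) + seminorm μ s Ω u < ∞

/-- The space `W^{s,1}_0(Ω)`: functions of `W^{s,1}(X)` that vanish a.e. outside `Ω`. -/
def MemW₀ (μ : Measure X) (s : ℝ) (Ω : Set X) (η : X → EReal) : Prop :=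
  MemW μ s univ η ∧ ∀ᵐ x ∂μ, x ∉ Ω → η x = 0

/-- `(∫_Ω ∫_Ω + 2 ∫_Ω ∫_{Ωᶜ}) (|u(x)-u(y)| - |v(x)-v(y)|)₊ / (μ(B_{x,y}) d(x,y)^s) dμ(x) dμ(y)`.
The subtraction of `ℝ≥0∞` is the positive part of the difference, and `∞ - ∞ = 0`. -/
def energyPos (μ : Measure X) (s : ℝ) (Ω : Set X) (u v : X → EReal) : ℝ≥0∞ :=
  (∫⁻ y in Ω, ∫⁻ x in Ω, (absDiff u x y - absDiff v x y) / weight μ s x y ∂μ ∂μ) +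
    2 * ∫⁻ y in Ω, ∫⁻ x in Ωᶜ, (absDiff u x y - absDiff v x y) / weight μ s x y ∂μ ∂μ

/-- The functional
`F(u,v) = (∫_Ω ∫_Ω + 2 ∫_Ω ∫_{Ωᶜ}) (|u(x)-u(y)| - |v(x)-v(y)|) / (μ(B_{x,y}) d(x,y)^s) dμ(x) dμ(y)`,
the integral of the positive part of the integrand minus that of its negative part (the negative
part of `a - b` is the positive part of `b - a`). For `v = u + η` with `u` finite a.e. on `Ω` and
`η ∈ W^{s,1}_0(Ω)`, both are at most `2 ∫_X ∫_X |η(x)-η(y)| / (μ(B_{x,y}) d(x,y)^s)`, so they are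
finite and the difference is an ordinary difference of real numbers. -/
def energyDiff (μ : Measure X) (s : ℝ) (Ω : Set X) (u v : X → EReal) : EReal :=
  (energyPos μ s Ω u v : EReal) - (energyPos μ s Ω v u : EReal)

/-- `u : X → [-∞,∞]` is an `s`-superminimizer in `Ω`. -/
structure IsSuperminimizer (μ : Measure X) (s : ℝ) (Ω : Set X) (u : X → EReal) : Prop where
  aemeasurable : AEMeasurable u μ
  memHomogW : MemHomogW μ s Ω u
  energyDiff_le : ∀ η : X → EReal, MemW₀ μ s Ω η → (∀ x, 0 ≤ η x) →
    energyDiff μ s Ω u (fun x => u x + η x) ≤ 0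

/-- `u : X → [-∞,∞]` is an `s`-subminimizer in `Ω`. -/
structure IsSubminimizer (μ : Measure X) (s : ℝ) (Ω : Set X) (u : X → EReal) : Prop where
  aemeasurable : AEMeasurable u μ
  memHomogW : MemHomogW μ s Ω u
  energyDiff_le : ∀ η : X → EReal, MemW₀ μ s Ω η → (∀ x, η x ≤ 0) →
    energyDiff μ s Ω u (fun x => u x + η x) ≤ 0

/-- The lower approximate limit `u^∧(x)`, a supremum in `[-∞,∞]` over real `t`. -/
def lowerApproxLimit (μ : Measure X) (u : X → EReal) (x : X) : EReal :=
  sSup ((fun t : ℝ => (t : EReal)) '' {t : ℝ |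
    Tendsto (fun r : ℝ => μ {y | y ∈ ball x r ∧ u y < (t : EReal)} / μ (ball x r))
      (𝓝[>] 0) (𝓝 0)})

/-- The upper approximate limit `u^∨(x)`, an infimum in `[-∞,∞]` over real `t`. -/
def upperApproxLimit (μ : Measure X) (u : X → EReal) (x : X) : EReal :=
  sInf ((fun t : ℝ => (t : EReal)) '' {t : ℝ |
    Tendsto (fun r : ℝ => μ {y | y ∈ ball x r ∧ (t : EReal) < u y} / μ (ball x r))
      (𝓝[>] 0) (𝓝 0)})

end NonlocalMin

end

/-!
The proof is a De Giorgi iteration at a single level `t`, and it needs neither connectedness nor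
completeness of the space.

Let `u` be a superminimizer and `φ` a cutoff function for a ball in `Ω`. The test function
`η = φ · min((t - u)₊, h)` is an antitone one-Lipschitz function of `u`, times `φ`. Where `φ = 1`,
adding it to `u` lowers `|u(x) - u(y)|` by exactly `|η(x) - η(y)|`; in general the loss is at most
`2h |φ(x) - φ(y)|`, on pairs that meet the sublevel set `A = {u < t}` in the support of `φ`
(`caccioppoli_pointwise`). No tail of `u` enters, which is special to the exponent one. As
`∫ |φ(x) - φ(y)| / weight dμ(x) ≤ K δ^{-s}` for a cutoff at scale `δ`
(`IsDoublingWith.exists_hasKernelBound`), minimality bounds the energy of `η` by a multiple of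
`h δ^{-s} μ(A)` (`caccioppoli`).

Conversely, if every ball of radius `ρ` around a point of `A` is at least half outside `A`, then
`∫ η` is at most a multiple of `ρ^s` times the energy of `η` (`lintegral_le_energy`). Dividing by
`h` and letting `h → 0` gives `μ({u < t} ∩ B_r) ≤ c (ρ/δ)^s μ({u < t} ∩ B_{r+δ})`
(`measure_sublevel_le`). Along the radii `R/2 (1 + 2^{-k})`, with `δ ~ 2^{-k} R` and `ρ/δ` a fixed
small number, the measures decay geometrically and, by doubling, fast enough for the smallness
condition to persist. Hence, if `{u < t}` occupies a small enough fraction of `B_R`, it is null in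
`B_{R/2}` (`exists_measure_sublevel_eq_zero`). Thus zero density at a point of `Ω` spreads to a
neighbourhood, which is lower semicontinuity of the lower approximate limit. Subminimizers are
reflected superminimizers (`IsSubminimizer.neg`).
-/

noncomputable section

namespace NonlocalMin

/-! ### Doubling measures and the weight -/

/-- `μ` is doubling with the explicit constant `C`. -/
def IsDoublingWith {X : Type*} [MetricSpace X] [MeasurableSpace X] (μ : Measure X)
    (C : ℝ≥0) : Prop :=
  ∀ (x : X) (r : ℝ), 0 < r →
    0 < μ (ball x r) ∧ μ (ball x r) < ∞ ∧ μ (ball x (2 * r)) ≤ C * μ (ball x r)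

section

variable {X : Type*} [MetricSpace X] [MeasurableSpace X] {μ : Measure X} {C : ℝ≥0} {s : ℝ}

lemma IsDoubling.exists_two_le (h : IsDoubling μ) : ∃ C : ℝ≥0, 2 ≤ C ∧ IsDoublingWith μ C := by
  obtain ⟨C, hC⟩ := h
  refine ⟨max C 2, le_max_right _ _, fun x r hr => ⟨(hC x r hr).1, (hC x r hr).2.1, ?_⟩⟩
  refine (hC x r hr).2.2.trans ?_
  gcongr
  exact le_max_left _ _

lemma IsDoublingWith.isLocallyFiniteMeasure (h : IsDoublingWith μ C) :
    IsLocallyFiniteMeasure μ :=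
  ⟨fun x => ⟨ball x 1, ball_mem_nhds x one_pos, (h x 1 one_pos).2.1⟩⟩

lemma IsDoublingWith.measure_ball_two_pow_mul_le (h : IsDoublingWith μ C) (x : X) {r : ℝ}
    (hr : 0 < r) (n : ℕ) : μ (ball x (2 ^ n * r)) ≤ (C : ℝ≥0∞) ^ n * μ (ball x r) := by
  induction n with
  | zero => simp
  | succ n ih =>
    calc μ (ball x (2 ^ (n + 1) * r)) = μ (ball x (2 * (2 ^ n * r))) := by congr 2; ring
      _ ≤ C * μ (ball x (2 ^ n * r)) := (h x _ (by positivity)).2.2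
      _ ≤ C * ((C : ℝ≥0∞) ^ n * μ (ball x r)) := by gcongr
      _ = (C : ℝ≥0∞) ^ (n + 1) * μ (ball x r) := by ring

lemma weight_comm (μ : Measure X) (s : ℝ) (x y : X) : weight μ s x y = weight μ s y x := by
  simp only [weight, edist_comm x y, Set.union_comm]

lemma measurable_weight [SecondCountableTopology X] [BorelSpace X] [SFinite μ] (s : ℝ) :
    Measurable fun p : X × X => weight μ s p.1 p.2 := by
  have hS₁ : IsOpen {q : (X × X) × X | dist q.2 q.1.1 < dist q.1.1 q.1.2} :=
    isOpen_lt (by fun_prop) (by fun_prop)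
  have hS₂ : IsOpen {q : (X × X) × X | dist q.2 q.1.2 < dist q.1.2 q.1.1} :=
    isOpen_lt (by fun_prop) (by fun_prop)
  have h := measurable_measure_prodMk_left (ν := μ) (hS₁.union hS₂).measurableSet
  exact h.mul ((measurable_edist).pow_const s)

/-- The integral over a dyadic annulus: doubling makes the measure of the annulus comparable to
the factor `μ(B_{x,y})` of the weight. -/
lemma lintegral_annulus_le [OpensMeasurableSpace X] (h : IsDoublingWith μ C) (hs : 0 < s) (y : X)
    {r : ℝ} (hr : 0 < r)
    {f : X → ℝ≥0∞} {c : ℝ≥0∞} (hf : ∀ x, r ≤ dist x y → dist x y < 2 * r → f x ≤ c) :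
    ∫⁻ x in {x | r ≤ dist x y ∧ dist x y < 2 * r}, f x / weight μ s x y ∂μ ≤
      C * (c / ENNReal.ofReal r ^ s) := by
  have hmeas : MeasurableSet {x | r ≤ dist x y ∧ dist x y < 2 * r} := by
    have h₁ : MeasurableSet {x | r ≤ dist x y} := measurableSet_le (by fun_prop) (by fun_prop)
    have h₂ : MeasurableSet {x | dist x y < 2 * r} := measurableSet_lt (by fun_prop) (by fun_prop)
    exact h₁.inter h₂
  obtain ⟨h0, h1, h2⟩ := h y r hr
  have hw : ∀ x ∈ {x | r ≤ dist x y ∧ dist x y < 2 * r},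
      f x / weight μ s x y ≤ c / (μ (ball y r) * ENNReal.ofReal r ^ s) := by
    rintro x ⟨hx1, hx2⟩
    refine ENNReal.div_le_div (hf x hx1 hx2) ?_
    unfold weight
    gcongr
    · refine (ball_subset_ball ?_).trans subset_union_right
      rwa [dist_comm]
    · rw [edist_dist]
      exact ENNReal.ofReal_le_ofReal hx1
  calc ∫⁻ x in {x | r ≤ dist x y ∧ dist x y < 2 * r}, f x / weight μ s x y ∂μ
      ≤ ∫⁻ x in {x | r ≤ dist x y ∧ dist x y < 2 * r},
          c / (μ (ball y r) * ENNReal.ofReal r ^ s) ∂μ := setLIntegral_mono' hmeas hw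
    _ = c / (μ (ball y r) * ENNReal.ofReal r ^ s) *
          μ {x | r ≤ dist x y ∧ dist x y < 2 * r} := setLIntegral_const _ _
    _ ≤ c / (μ (ball y r) * ENNReal.ofReal r ^ s) * (C * μ (ball y r)) := by
        gcongr
        exact (measure_mono fun x hx => mem_ball.2 hx.2).trans h2
    _ = C * (c / ENNReal.ofReal r ^ s) * (μ (ball y r) * (μ (ball y r))⁻¹) := by
        rw [div_eq_mul_inv, ENNReal.mul_inv (Or.inl h0.ne') (Or.inl h1.ne), div_eq_mul_inv]
        ring
    _ = C * (c / ENNReal.ofReal r ^ s) := by rw [ENNReal.mul_inv_cancel h0.ne' h1.ne, mul_one]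

lemma summable_min_one_two_zpow_mul (hs0 : 0 < s) (hs1 : s < 1) :
    Summable fun n : ℤ => min 1 ((2 : ℝ) ^ (n + 1)) * ((2 : ℝ) ^ n) ^ (-s) := by
  refine Summable.of_nat_of_neg_add_one ?_ ?_
  · have hg : Summable fun n : ℕ => ((2 : ℝ) ^ (-s)) ^ n :=
      summable_geometric_of_lt_one (by positivity)
        (Real.rpow_lt_one_of_one_lt_of_neg one_lt_two (by linarith))
    refine Summable.of_nonneg_of_le (fun n => by positivity) (fun n => ?_) hg
    rw [zpow_natCast, ← Real.rpow_natCast, ← Real.rpow_mul two_pos.le, ← Real.rpow_natCast,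
      ← Real.rpow_mul two_pos.le, mul_comm (n : ℝ)]
    exact mul_le_of_le_one_left (by positivity) (min_le_left _ _)
  · have hg : Summable fun n : ℕ => (2 : ℝ) ^ s * ((2 : ℝ) ^ (s - 1)) ^ n :=
      (summable_geometric_of_lt_one (by positivity)
        (Real.rpow_lt_one_of_one_lt_of_neg one_lt_two (by linarith))).mul_left _
    refine Summable.of_nonneg_of_le (fun n => by positivity) (fun n => ?_) hg
    refine (mul_le_mul_of_nonneg_right (min_le_right _ _) (by positivity)).trans_eq ?_
    rw [← Real.rpow_intCast, ← Real.rpow_intCast, ← Real.rpow_mul two_pos.le, ← Real.rpow_natCast,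
      ← Real.rpow_mul two_pos.le, ← Real.rpow_add two_pos, ← Real.rpow_add two_pos]
    congr 1
    push_cast
    ring

/-- `K δ^{-s}` bounds the integral of `1 / weight`, one variable being fixed, against functions that
are bounded by one and by the distance to that variable divided by `δ`. -/
def HasKernelBound (μ : Measure X) (s : ℝ) (K : ℝ≥0∞) : Prop :=
  ∀ (y : X) (δ : ℝ), 0 < δ → ∀ f : X → ℝ≥0∞, (∀ x, f x ≤ 1) →
    (∀ x, f x ≤ ENNReal.ofReal (dist x y / δ)) →
      ∫⁻ x, f x / weight μ s x y ∂μ ≤ K / ENNReal.ofReal δ ^ s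

/-- The kernel is integrable against a function that is bounded by one and Lipschitz at `y`. Near
`y` this uses `s < 1`, far from `y` it uses `0 < s`. -/
lemma IsDoublingWith.exists_hasKernelBound [OpensMeasurableSpace X] (h : IsDoublingWith μ C)
    (hs0 : 0 < s) (hs1 : s < 1) : ∃ K : ℝ≥0∞, K ≠ ∞ ∧ HasKernelBound μ s K := by
  have hsum := summable_min_one_two_zpow_mul hs0 hs1
  refine ⟨C * ∑' n : ℤ, ENNReal.ofReal (min 1 ((2 : ℝ) ^ (n + 1)) * ((2 : ℝ) ^ n) ^ (-s)),
    ENNReal.mul_ne_top ENNReal.coe_ne_top hsum.tsum_ofReal_ne_top, ?_⟩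
  intro y δ hδ f hf1 hf2
  set A : ℤ → Set X := fun n => {x | 2 ^ n * δ ≤ dist x y ∧ dist x y < 2 * (2 ^ n * δ)} with hA
  have hcover : ∀ x, f x / weight μ s x y ≤
      (⋃ n, A n).indicator (fun x => f x / weight μ s x y) x := by
    intro x
    by_cases hx : x ∈ ⋃ n, A n
    · rw [indicator_of_mem hx]
    · have hxy : dist x y = 0 := by
        by_contra hne
        have hpos : 0 < dist x y / δ := div_pos (lt_of_le_of_ne dist_nonneg (Ne.symm hne)) hδ
        obtain ⟨n, hn1, hn2⟩ := exists_mem_Ico_zpow hpos (one_lt_two (α := ℝ))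
        refine hx (mem_iUnion.2 ⟨n, (le_div_iff₀ hδ).1 hn1, ?_⟩)
        rw [div_lt_iff₀ hδ, zpow_add_one₀ two_ne_zero] at hn2
        linarith
      have hf0 : f x = 0 := by simpa [hxy] using hf2 x
      simp [hf0]
  have hA_le : ∀ n, ∫⁻ x in A n, f x / weight μ s x y ∂μ ≤
      C * ENNReal.ofReal (min 1 ((2 : ℝ) ^ (n + 1)) * ((2 : ℝ) ^ n) ^ (-s)) /
        ENNReal.ofReal δ ^ s := by
    intro n
    have h2n : (0 : ℝ) < 2 ^ n := by positivity
    refine (lintegral_annulus_le h hs0 y (r := 2 ^ n * δ) (by positivity)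
      (c := ENNReal.ofReal (min 1 ((2 : ℝ) ^ (n + 1)))) fun x _ hx => ?_).trans_eq ?_
    · rw [ENNReal.ofReal_min, ENNReal.ofReal_one]
      refine le_min (hf1 x) ((hf2 x).trans (ENNReal.ofReal_le_ofReal ?_))
      rw [div_le_iff₀ hδ, zpow_add_one₀ two_ne_zero]
      linarith
    · rw [ENNReal.ofReal_mul h2n.le, ENNReal.mul_rpow_of_nonneg _ _ hs0.le,
        ENNReal.ofReal_mul (by positivity), ← ENNReal.ofReal_rpow_of_pos h2n, ENNReal.rpow_neg,
        div_eq_mul_inv, div_eq_mul_inv, ENNReal.mul_inv (Or.inr (by simp [hs0.le]))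
          (Or.inr (by simp [hδ, hs0]))]
      ring
  calc ∫⁻ x, f x / weight μ s x y ∂μ
      ≤ ∫⁻ x, (⋃ n, A n).indicator (fun x => f x / weight μ s x y) x ∂μ := lintegral_mono hcover
    _ ≤ ∫⁻ x in ⋃ n, A n, f x / weight μ s x y ∂μ := lintegral_indicator_le _ _
    _ ≤ ∑' n, ∫⁻ x in A n, f x / weight μ s x y ∂μ := lintegral_iUnion_le _ _
    _ ≤ ∑' n : ℤ, C * ENNReal.ofReal (min 1 ((2 : ℝ) ^ (n + 1)) * ((2 : ℝ) ^ n) ^ (-s)) /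
          ENNReal.ofReal δ ^ s := ENNReal.tsum_le_tsum hA_le
    _ = _ := by simp only [div_eq_mul_inv]; rw [ENNReal.tsum_mul_right, ENNReal.tsum_mul_left]

end

/-! ### The truncated test function -/

/-- The truncation `min((t - a)₊, h)`. -/
def trunc (t h a : ℝ) : ℝ := max 0 (min (t - a) h)

/-- The test function `φ · min((t - u)₊, h)`. The real part of `u` suffices because `φ` is meant
to vanish wherever `u` is infinite. -/
def testFun {X : Type*} (φ : X → ℝ) (t h : ℝ) (u : X → EReal) (x : X) : ℝ :=
  φ x * trunc t h (u x).toReal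

lemma trunc_nonneg (t h a : ℝ) : 0 ≤ trunc t h a := le_max_left _ _

lemma trunc_le {h : ℝ} (hh : 0 ≤ h) (t a : ℝ) : trunc t h a ≤ h := max_le hh (min_le_right _ _)

lemma trunc_of_le {t a : ℝ} (h : ℝ) (hta : t ≤ a) : trunc t h a = 0 :=
  max_eq_left ((min_le_left _ _).trans (by linarith))

lemma trunc_antitone {a b : ℝ} (t h : ℝ) (hab : a ≤ b) : trunc t h b ≤ trunc t h a :=
  max_le_max le_rfl (min_le_min (by linarith) le_rfl)

lemma trunc_sub_le {a b : ℝ} (t h : ℝ) (hab : a ≤ b) : trunc t h a - trunc t h b ≤ b - a := by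
  have h₁ := le_max_left 0 (min (t - b) h)
  have h₂ := le_max_right 0 (min (t - b) h)
  rw [sub_le_iff_le_add]
  refine max_le (by unfold trunc; linarith) ?_
  rcases min_cases (t - b) h with ⟨he, _⟩ | ⟨he, _⟩
  · exact (min_le_left _ _).trans (by unfold trunc; linarith)
  · exact (min_le_right _ _).trans (by unfold trunc; linarith)

lemma abs_trunc_sub_le (t h a b : ℝ) : |trunc t h a - trunc t h b| ≤ |a - b| := by
  rcases le_total a b with hab | hab
  · rw [abs_of_nonneg (sub_nonneg.2 (trunc_antitone t h hab)), abs_sub_comm,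
      abs_of_nonneg (sub_nonneg.2 hab)]
    exact trunc_sub_le t h hab
  · rw [abs_sub_comm, abs_of_nonneg (sub_nonneg.2 (trunc_antitone t h hab)),
      abs_of_nonneg (sub_nonneg.2 hab)]
    exact trunc_sub_le t h hab

/-- Since the truncation is antitone and one-Lipschitz, adding a fraction `p` of it to `a`
decreases differences by exactly that fraction of the difference of the truncations. -/
lemma abs_add_mul_trunc_sub {p : ℝ} (hp0 : 0 ≤ p) (hp1 : p ≤ 1) (t h a b : ℝ) :
    |a - b + p * (trunc t h a - trunc t h b)| = |a - b| - p * |trunc t h a - trunc t h b| := by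
  wlog hab : a ≤ b generalizing a b
  · rw [abs_sub_comm a b, abs_sub_comm (trunc t h a), ← this b a (le_of_not_ge hab), ← abs_neg]
    congr 1
    ring
  have h₁ := sub_nonneg.2 (trunc_antitone t h hab)
  have h₂ := trunc_sub_le t h hab
  rw [abs_of_nonneg h₁, abs_of_nonpos (by linarith : a - b ≤ 0), abs_of_nonpos (by nlinarith)]
  ring

lemma abs_mul_trunc_sub_le {p : ℝ} (hp0 : 0 ≤ p) (q t h a b : ℝ) :
    |p * trunc t h a - q * trunc t h b| ≤
      p * |trunc t h a - trunc t h b| + trunc t h b * |p - q| := by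
  have he : p * trunc t h a - q * trunc t h b =
    p * (trunc t h a - trunc t h b) + trunc t h b * (p - q) := by ring
  rw [he]
  refine (abs_add_le _ _).trans_eq ?_
  rw [abs_mul, abs_mul, abs_of_nonneg hp0, abs_of_nonneg (trunc_nonneg t h b)]

/-- The pointwise Caccioppoli inequality: up to a term that sees the cutoff only, the energy gained
by adding the test function is the full energy of the test function. -/
lemma abs_test_sub_add_abs_le {p : ℝ} (hp0 : 0 ≤ p) (hp1 : p ≤ 1) (q t h a b : ℝ) :
    |p * trunc t h a - q * trunc t h b| +
        |(a + p * trunc t h a) - (b + q * trunc t h b)| ≤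
      |a - b| + 2 * trunc t h b * |p - q| := by
  have h₁ := abs_mul_trunc_sub_le hp0 q t h a b
  have h₂ := abs_add_mul_trunc_sub hp0 hp1 t h a b
  have he : (a + p * trunc t h a) - (b + q * trunc t h b) =
    (a - b + p * (trunc t h a - trunc t h b)) + trunc t h b * (p - q) := by ring
  have h₃ := abs_add_le (a - b + p * (trunc t h a - trunc t h b)) (trunc t h b * (p - q))
  rw [← he, h₂, abs_mul, abs_of_nonneg (trunc_nonneg t h b)] at h₃
  linarith

section

variable {X : Type*} {φ : X → ℝ} {u : X → EReal} {B : Set X} {t h : ℝ}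

lemma absDiff_coe (f : X → ℝ) (x y : X) :
    absDiff (fun z => (f z : EReal)) x y = ENNReal.ofReal |f x - f y| := by
  rw [absDiff, ← EReal.coe_sub, EReal.abs_def]

lemma absDiff_comm (u : X → EReal) (x y : X) : absDiff u x y = absDiff u y x := by
  unfold absDiff
  induction u x with
  | coe a =>
    induction u y with
    | coe b => rw [← EReal.coe_sub, ← EReal.coe_sub, EReal.abs_def, EReal.abs_def, abs_sub_comm]
    | _ => simp
  | _ => induction u y <;> simp

lemma absDiff_eq_top {x : X} (hx : u x = ⊤ ∨ u x = ⊥) (y : X) : absDiff u x y = ∞ := by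
  unfold absDiff
  rcases hx with hx | hx <;> rw [hx] <;> induction u y <;> simp

lemma testFun_nonneg (hφ0 : ∀ x, 0 ≤ φ x) (x : X) : 0 ≤ testFun φ t h u x :=
  mul_nonneg (hφ0 x) (trunc_nonneg _ _ _)

lemma testFun_le (hφ0 : ∀ x, 0 ≤ φ x) (hh : 0 ≤ h) (x : X) : testFun φ t h u x ≤ h * φ x := by
  rw [testFun, mul_comm]
  exact mul_le_mul_of_nonneg_right (trunc_le hh _ _) (hφ0 x)

lemma testFun_eq_zero (hφB : ∀ x, x ∉ B → φ x = 0)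
    (hfin : ∀ x, (u x ≠ ⊤ ∧ u x ≠ ⊥) ∨ φ x = 0) {x : X} (hx : x ∉ {z | z ∈ B ∧ u z < t}) :
    testFun φ t h u x = 0 := by
  rcases hfin x with hf | hf
  · by_cases hB : x ∈ B
    · have htu : (t : EReal) ≤ u x := not_lt.1 fun hlt => hx ⟨hB, hlt⟩
      rw [testFun, trunc_of_le, mul_zero]
      rw [← EReal.coe_toReal hf.1 hf.2] at htu
      exact_mod_cast htu
    · rw [testFun, hφB x hB, zero_mul]
  · rw [testFun, hf, zero_mul]

/-- The extended real form of the pointwise Caccioppoli inequality. The error is supported where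
one of the two points lies in the sublevel set. Where `u` is infinite both energy densities are
infinite, their difference is zero by convention, and the error term alone dominates. -/
lemma caccioppoli_pointwise (hφ0 : ∀ x, 0 ≤ φ x) (hφ1 : ∀ x, φ x ≤ 1)
    (hφB : ∀ x, x ∉ B → φ x = 0) (hfin : ∀ x, (u x ≠ ⊤ ∧ u x ≠ ⊥) ∨ φ x = 0) (hh : 0 ≤ h)
    (x y : X) :
    ENNReal.ofReal |testFun φ t h u x - testFun φ t h u y| +
        (absDiff (fun z => u z + testFun φ t h u z) x y - absDiff u x y) ≤
      (absDiff u x y - absDiff (fun z => u z + testFun φ t h u z) x y) +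
        ENNReal.ofReal (2 * h) * (({z | z ∈ B ∧ u z < t}.indicator 1 x +
          {z | z ∈ B ∧ u z < t}.indicator 1 y) * ENNReal.ofReal |φ x - φ y|) := by
  set A := {z | z ∈ B ∧ u z < t} with hA
  have hzero : ∀ z, z ∉ A → testFun φ t h u z = 0 := fun z hz => testFun_eq_zero hφB hfin hz
  have hind : x ∈ A ∨ y ∈ A → (1 : ℝ≥0∞) ≤ A.indicator 1 x + A.indicator 1 y := by
    rintro (hz | hz)
    · rw [indicator_of_mem hz]; exact le_self_add
    · rw [indicator_of_mem hz]; exact le_add_self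
  have herr : x ∈ A ∨ y ∈ A → ENNReal.ofReal (2 * h * |φ x - φ y|) ≤
      ENNReal.ofReal (2 * h) * ((A.indicator 1 x + A.indicator 1 y) *
        ENNReal.ofReal |φ x - φ y|) := by
    intro hz
    rw [ENNReal.ofReal_mul (by positivity)]
    gcongr
    exact le_mul_of_one_le_left' (hind hz)
  by_cases hxy : x ∈ A ∨ y ∈ A
  swap
  · -- Off the sublevel set the test function vanishes and nothing changes.
    rw [not_or] at hxy
    have hadd : absDiff (fun z => u z + testFun φ t h u z) x y = absDiff u x y := by
      simp [absDiff, hzero x hxy.1, hzero y hxy.2]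
    rw [hadd, hzero x hxy.1, hzero y hxy.2]
    simp
  refine le_trans ?_ (add_le_add le_rfl (herr hxy))
  have hinf : ∀ z, ¬ (u z ≠ ⊤ ∧ u z ≠ ⊥) →
      (u z = ⊤ ∨ u z = ⊥) ∧ φ z = 0 ∧ testFun φ t h u z = 0 ∧
        (u z + testFun φ t h u z = ⊤ ∨ u z + testFun φ t h u z = ⊥) := by
    intro z hz
    have hφz : φ z = 0 := (hfin z).resolve_left hz
    have htz : testFun φ t h u z = 0 := by rw [testFun, hφz, zero_mul]
    have huz : u z = ⊤ ∨ u z = ⊥ := by tauto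
    exact ⟨huz, hφz, htz, by simpa [htz] using huz⟩
  have hbound : ∀ z, testFun φ t h u z ≤ 2 * h * φ z := fun z =>
    (testFun_le hφ0 hh z).trans (by have := mul_nonneg hh (hφ0 z); linarith)
  by_cases hx : u x ≠ ⊤ ∧ u x ≠ ⊥
  swap
  · obtain ⟨h₁, h₂, h₃, h₄⟩ := hinf x hx
    rw [absDiff_eq_top h₁,
      absDiff_eq_top (u := fun z => u z + testFun φ t h u z) h₄, h₂, h₃]
    simp only [tsub_self, add_zero, zero_add, zero_sub, abs_neg, abs_of_nonneg (hφ0 y),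
      abs_of_nonneg (testFun_nonneg hφ0 y)]
    exact ENNReal.ofReal_le_ofReal (hbound y)
  by_cases hy : u y ≠ ⊤ ∧ u y ≠ ⊥
  swap
  · obtain ⟨h₁, h₂, h₃, h₄⟩ := hinf y hy
    rw [absDiff_comm, absDiff_comm u x, absDiff_eq_top h₁,
      absDiff_eq_top (u := fun z => u z + testFun φ t h u z) h₄, h₂, h₃]
    simp only [tsub_self, add_zero, zero_add, sub_zero, abs_of_nonneg (hφ0 x),
      abs_of_nonneg (testFun_nonneg hφ0 x)]
    exact ENNReal.ofReal_le_ofReal (hbound x)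
  obtain ⟨a, ha⟩ : ∃ a : ℝ, u x = a := ⟨_, (EReal.coe_toReal hx.1 hx.2).symm⟩
  obtain ⟨b, hb⟩ : ∃ b : ℝ, u y = b := ⟨_, (EReal.coe_toReal hy.1 hy.2).symm⟩
  have hη : ∀ z, testFun φ t h u z = φ z * trunc t h (u z).toReal := fun _ => rfl
  have hu : absDiff u x y = ENNReal.ofReal |a - b| := by
    rw [absDiff, ha, hb, ← EReal.coe_sub, EReal.abs_def]
  have hv : absDiff (fun z => u z + testFun φ t h u z) x y =
      ENNReal.ofReal |(a + φ x * trunc t h a) - (b + φ y * trunc t h b)| := by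
    rw [absDiff, hη, hη, ha, hb, EReal.toReal_coe, EReal.toReal_coe, ← EReal.coe_add,
      ← EReal.coe_add, ← EReal.coe_sub, EReal.abs_def]
  rw [hu, hv, hη, hη, ha, hb, EReal.toReal_coe, EReal.toReal_coe,
    ← ENNReal.ofReal_sub _ (abs_nonneg _), ← ENNReal.ofReal_sub _ (abs_nonneg _)]
  have key : |φ x * trunc t h a - φ y * trunc t h b| +
      |(a + φ x * trunc t h a) - (b + φ y * trunc t h b)| ≤ |a - b| + 2 * h * |φ x - φ y| := by
    refine (abs_test_sub_add_abs_le (hφ0 x) (hφ1 x) (φ y) t h a b).trans ?_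
    gcongr
    exact trunc_le hh t b
  set Y := |(a + φ x * trunc t h a) - (b + φ y * trunc t h b)|
  have hnn := abs_nonneg (φ x * trunc t h a - φ y * trunc t h b)
  have hnn' : 0 ≤ 2 * h * |φ x - φ y| := by positivity
  rcases le_total Y |a - b| with hle | hle
  · rw [ENNReal.ofReal_of_nonpos (by linarith : Y - |a - b| ≤ 0), add_zero,
      ← ENNReal.ofReal_add (by linarith) hnn']
    exact ENNReal.ofReal_le_ofReal (by linarith)
  · rw [ENNReal.ofReal_of_nonpos (by linarith : |a - b| - Y ≤ 0), zero_add,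
      ← ENNReal.ofReal_add hnn (by linarith)]
    exact ENNReal.ofReal_le_ofReal (by linarith)

/-- The negative part of the energy density is dominated by the density of the test function. -/
lemma absDiff_add_tsub_le (x y : X) :
    absDiff (fun z => u z + testFun φ t h u z) x y - absDiff u x y ≤
      ENNReal.ofReal |testFun φ t h u x - testFun φ t h u y| := by
  by_cases hx : u x ≠ ⊤ ∧ u x ≠ ⊥
  swap
  · rw [absDiff_eq_top (by tauto : u x = ⊤ ∨ u x = ⊥)]; simp
  by_cases hy : u y ≠ ⊤ ∧ u y ≠ ⊥
  swap
  · rw [absDiff_comm u, absDiff_eq_top (by tauto : u y = ⊤ ∨ u y = ⊥)]; simp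
  obtain ⟨a, ha⟩ : ∃ a : ℝ, u x = a := ⟨_, (EReal.coe_toReal hx.1 hx.2).symm⟩
  obtain ⟨b, hb⟩ : ∃ b : ℝ, u y = b := ⟨_, (EReal.coe_toReal hy.1 hy.2).symm⟩
  rw [absDiff, absDiff, ha, hb, ← EReal.coe_add, ← EReal.coe_add, ← EReal.coe_sub,
    ← EReal.coe_sub, EReal.abs_def, EReal.abs_def, tsub_le_iff_right,
    ← ENNReal.ofReal_add (abs_nonneg _) (abs_nonneg _)]
  refine ENNReal.ofReal_le_ofReal ?_
  refine le_trans (le_of_eq ?_) (abs_add_le _ _)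
  congr 1
  ring

/-- The density of the test function is dominated by that of `u` inside `Ω` and by that of the
cutoff. -/
lemma abs_testFun_sub_le {Ω : Set X} (hφ0 : ∀ x, 0 ≤ φ x) (hφ1 : ∀ x, φ x ≤ 1)
    (hφB : ∀ x, x ∉ B → φ x = 0) (hBΩ : B ⊆ Ω) (hfin : ∀ x ∈ Ω, u x ≠ ⊤ ∧ u x ≠ ⊥) (hh : 0 ≤ h)
    (x y : X) :
    ENNReal.ofReal |testFun φ t h u x - testFun φ t h u y| ≤
      Ω.indicator 1 x * Ω.indicator 1 y * absDiff u x y +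
        ENNReal.ofReal h * ((B.indicator 1 x + B.indicator 1 y) *
          ENNReal.ofReal |φ x - φ y|) := by
  by_cases hxy : x ∈ B ∨ y ∈ B
  swap
  · rw [not_or] at hxy
    simp [testFun, hφB x hxy.1, hφB y hxy.2]
  have hind : (1 : ℝ≥0∞) ≤ B.indicator 1 x + B.indicator 1 y := by
    rcases hxy with hz | hz
    · rw [indicator_of_mem hz]; exact le_self_add
    · rw [indicator_of_mem hz]; exact le_add_self
  have herr : ENNReal.ofReal (h * |φ x - φ y|) ≤
      ENNReal.ofReal h * ((B.indicator 1 x + B.indicator 1 y) *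
        ENNReal.ofReal |φ x - φ y|) := by
    rw [ENNReal.ofReal_mul hh]
    gcongr
    exact le_mul_of_one_le_left' hind
  refine le_trans ?_ (add_le_add le_rfl herr)
  have hout : ∀ z, z ∉ Ω → φ z = 0 ∧ testFun φ t h u z = 0 := fun z hz =>
    have hφz := hφB z fun hB => hz (hBΩ hB)
    ⟨hφz, by rw [testFun, hφz, zero_mul]⟩
  by_cases hx : x ∈ Ω
  swap
  · refine le_add_left (ENNReal.ofReal_le_ofReal ?_)
    rw [(hout x hx).1, (hout x hx).2, zero_sub, zero_sub, abs_neg, abs_neg,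
      abs_of_nonneg (hφ0 y), abs_of_nonneg (testFun_nonneg hφ0 y)]
    exact testFun_le hφ0 hh y
  by_cases hy : y ∈ Ω
  swap
  · refine le_add_left (ENNReal.ofReal_le_ofReal ?_)
    rw [(hout y hy).1, (hout y hy).2, sub_zero, sub_zero,
      abs_of_nonneg (hφ0 x), abs_of_nonneg (testFun_nonneg hφ0 x)]
    exact testFun_le hφ0 hh x
  obtain ⟨a, ha⟩ : ∃ a : ℝ, u x = a :=
    ⟨_, (EReal.coe_toReal (hfin x hx).1 (hfin x hx).2).symm⟩
  obtain ⟨b, hb⟩ : ∃ b : ℝ, u y = b :=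
    ⟨_, (EReal.coe_toReal (hfin y hy).1 (hfin y hy).2).symm⟩
  rw [indicator_of_mem hx, indicator_of_mem hy, absDiff, ha, hb, ← EReal.coe_sub, EReal.abs_def,
    Pi.one_apply, Pi.one_apply, one_mul, one_mul,
    ← ENNReal.ofReal_add (abs_nonneg _) (by positivity)]
  refine ENNReal.ofReal_le_ofReal ?_
  rw [testFun, testFun, ha, hb, EReal.toReal_coe, EReal.toReal_coe]
  refine (abs_mul_trunc_sub_le (hφ0 x) (φ y) t h a b).trans (add_le_add ?_ ?_)
  · exact (mul_le_of_le_one_left (abs_nonneg _) (hφ1 x)).trans (abs_trunc_sub_le t h a b)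
  · gcongr
    exact trunc_le hh t b

end

/-! ### Integrated energies -/

section

variable {X : Type*} [MeasurableSpace X] {μ : Measure X} {Ω : Set X}

/-- The measure on `X × X` that turns `∫_Ω ∫_Ω + 2 ∫_Ω ∫_{Ωᶜ}` into a single integral; the second
coordinate is the outer variable. -/
def energyMeasure (μ : Measure X) (Ω : Set X) : Measure (X × X) :=
  (μ.restrict Ω + (2 : ℝ≥0∞) • μ.restrict Ωᶜ).prod (μ.restrict Ω)

lemma le_restrict_add_two_smul (hΩ : MeasurableSet Ω) :
    μ ≤ μ.restrict Ω + (2 : ℝ≥0∞) • μ.restrict Ωᶜ := by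
  conv_lhs => rw [← Measure.restrict_add_restrict_compl (μ := μ) hΩ]
  rw [two_smul]
  gcongr
  exact Measure.le_add_left le_rfl

lemma restrict_add_two_smul_le (hΩ : MeasurableSet Ω) :
    μ.restrict Ω + (2 : ℝ≥0∞) • μ.restrict Ωᶜ ≤ (2 : ℝ≥0∞) • μ := by
  conv_rhs => rw [← Measure.restrict_add_restrict_compl (μ := μ) hΩ, smul_add, two_smul]
  gcongr
  exact Measure.le_add_left le_rfl

variable [SFinite μ]

lemma lintegral_energyMeasure {G : X × X → ℝ≥0∞} (hG : Measurable G) :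
    ∫⁻ p, G p ∂energyMeasure μ Ω = (∫⁻ y in Ω, ∫⁻ x in Ω, G (x, y) ∂μ ∂μ) +
      2 * ∫⁻ y in Ω, ∫⁻ x in Ωᶜ, G (x, y) ∂μ ∂μ := by
  rw [energyMeasure, lintegral_prod_symm' _ hG]
  simp only [lintegral_add_measure, lintegral_smul_measure, smul_eq_mul]
  rw [lintegral_add_left hG.lintegral_prod_left', lintegral_const_mul _ hG.lintegral_prod_left']

lemma lintegral_energyMeasure_le (hΩ : MeasurableSet Ω) {G : X × X → ℝ≥0∞} (hG : Measurable G) :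
    ∫⁻ p, G p ∂energyMeasure μ Ω ≤ 2 * ∫⁻ p, G p ∂(μ.prod μ) := by
  rw [energyMeasure, lintegral_prod_symm' _ hG, lintegral_prod_symm' _ hG,
    ← lintegral_const_mul _ hG.lintegral_prod_left']
  refine (setLIntegral_le_lintegral _ _).trans (lintegral_mono fun y => ?_)
  rw [← smul_eq_mul, ← lintegral_smul_measure]
  exact lintegral_mono' (restrict_add_two_smul_le hΩ) le_rfl

lemma le_lintegral_energyMeasure (hΩ : MeasurableSet Ω) {G : X × X → ℝ≥0∞} (hG : Measurable G) :
    ∫⁻ y in Ω, ∫⁻ x, G (x, y) ∂μ ∂μ ≤ ∫⁻ p, G p ∂energyMeasure μ Ω := by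
  rw [energyMeasure, lintegral_prod_symm' _ hG]
  exact lintegral_mono fun y => lintegral_mono' (le_restrict_add_two_smul hΩ) le_rfl

lemma measurable_ereal_abs : Measurable EReal.abs := by
  refine EReal.measurable_of_measurable_real ?_
  simp only [EReal.abs_def]
  fun_prop

lemma measurable_absDiff {u : X → EReal} (hu : Measurable u) :
    Measurable fun p : X × X => absDiff u p.1 p.2 :=
  measurable_ereal_abs.comp ((hu.comp measurable_fst).sub (hu.comp measurable_snd))

end

section

variable {X : Type*} [MetricSpace X]

/-- `φ` is a cutoff function with values in `[0,1]` and Lipschitz constant `1/δ` that vanishes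
outside `B`. -/
structure IsCutoff (φ : X → ℝ) (B : Set X) (δ : ℝ) : Prop where
  pos : 0 < δ
  nonneg : ∀ x, 0 ≤ φ x
  le_one : ∀ x, φ x ≤ 1
  eq_zero : ∀ x, x ∉ B → φ x = 0
  abs_sub_le : ∀ x y, |φ x - φ y| ≤ dist x y / δ

lemma IsCutoff.continuous {φ : X → ℝ} {B : Set X} {δ : ℝ} (h : IsCutoff φ B δ) :
    Continuous φ := by
  refine LipschitzWith.continuous (K := Real.toNNReal δ⁻¹) (LipschitzWith.of_dist_le_mul ?_)
  intro x y
  rw [Real.coe_toNNReal _ (inv_nonneg.2 h.pos.le), Real.dist_eq, mul_comm, ← div_eq_mul_inv]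
  exact h.abs_sub_le x y

lemma IsCutoff.abs_sub_le_one {φ : X → ℝ} {B : Set X} {δ : ℝ} (h : IsCutoff φ B δ) (x y : X) :
    |φ x - φ y| ≤ 1 :=
  abs_sub_le_iff.2 ⟨by linarith [h.le_one x, h.nonneg y], by linarith [h.le_one y, h.nonneg x]⟩

lemma exists_isCutoff (x₀ : X) {r r' : ℝ} (hr : r < r') :
    ∃ φ : X → ℝ, IsCutoff φ (ball x₀ r') (r' - r) ∧ ∀ x ∈ ball x₀ r, φ x = 1 := by
  have hδ : 0 < r' - r := sub_pos.2 hr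
  refine ⟨fun x => max 0 (min 1 ((r' - dist x x₀) / (r' - r))), ⟨hδ, fun x => le_max_left _ _,
    fun x => max_le zero_le_one (min_le_left _ _), fun x hx => ?_, fun x y => ?_⟩, fun x hx => ?_⟩
  · rw [mem_ball, not_lt] at hx
    exact max_eq_left ((min_le_right _ _).trans
      (div_nonpos_of_nonpos_of_nonneg (by linarith) hδ.le))
  · refine (abs_max_sub_max_le_max _ _ _ _).trans (max_le (by simp; positivity) ?_)
    refine (abs_min_sub_min_le_max _ _ _ _).trans (max_le (by simp; positivity) ?_)
    rw [← sub_div, abs_div, abs_of_pos hδ]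
    gcongr
    have he : r' - dist x x₀ - (r' - dist y x₀) = dist y x₀ - dist x x₀ := by ring
    rw [he, dist_comm x y]
    exact abs_dist_sub_le _ _ _
  · rw [mem_ball] at hx
    have h1 : 1 ≤ (r' - dist x x₀) / (r' - r) := by rw [one_le_div hδ]; linarith
    simp [min_eq_left h1]

variable [MeasurableSpace X] [BorelSpace X] {μ : Measure X} {s : ℝ} {Ω : Set X} {φ : X → ℝ}
  {B : Set X} {t h δ : ℝ} {u : X → EReal} {K : ℝ≥0∞}

lemma measurable_testFun (hφ : IsCutoff φ B δ) (hu : Measurable u) :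
    Measurable (testFun φ t h u) := by
  have := hφ.continuous.measurable
  have := hu.ereal_toReal
  unfold testFun trunc
  fun_prop

variable [SFinite μ] [SecondCountableTopology X]

lemma energyPos_eq {u v : X → EReal} (hu : Measurable u) (hv : Measurable v) :
    energyPos μ s Ω u v = ∫⁻ p, (absDiff u p.1 p.2 - absDiff v p.1 p.2) / weight μ s p.1 p.2
      ∂energyMeasure μ Ω := by
  rw [lintegral_energyMeasure]
  · rfl
  · exact ((measurable_absDiff hu).sub (measurable_absDiff hv)).div (measurable_weight s)

/-- The energy of a cutoff, localized to one of the two variables by a density `a`. -/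
lemma lintegral_cutoff_le (hφ : IsCutoff φ B δ)
    (hK : HasKernelBound μ s K)
    {a : X → ℝ≥0∞} (ha : Measurable a) :
    ∫⁻ p, (a p.1 + a p.2) * ENNReal.ofReal |φ p.1 - φ p.2| / weight μ s p.1 p.2 ∂(μ.prod μ) ≤
      2 * (K / ENNReal.ofReal δ ^ s) * ∫⁻ x, a x ∂μ := by
  have hφm := hφ.continuous.measurable
  have hwm := measurable_weight (μ := μ) s
  have hkm : Measurable fun p : X × X =>
      ENNReal.ofReal |φ p.1 - φ p.2| / weight μ s p.1 p.2 :=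
    Measurable.div (by fun_prop) hwm
  have h₁ : Measurable fun p : X × X =>
      a p.1 * (ENNReal.ofReal |φ p.1 - φ p.2| / weight μ s p.1 p.2) :=
    (ha.comp measurable_fst).mul hkm
  have h₂ : Measurable fun p : X × X =>
      a p.2 * (ENNReal.ofReal |φ p.1 - φ p.2| / weight μ s p.1 p.2) :=
    (ha.comp measurable_snd).mul hkm
  have hswap : ∫⁻ p, a p.1 * (ENNReal.ofReal |φ p.1 - φ p.2| / weight μ s p.1 p.2) ∂(μ.prod μ) =
      ∫⁻ p, a p.2 * (ENNReal.ofReal |φ p.1 - φ p.2| / weight μ s p.1 p.2) ∂(μ.prod μ) := by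
    rw [← lintegral_prod_swap]
    refine lintegral_congr fun p => ?_
    simp only [Prod.fst_swap, Prod.snd_swap]
    rw [weight_comm, abs_sub_comm]
  have hone : ∫⁻ p, a p.2 * (ENNReal.ofReal |φ p.1 - φ p.2| / weight μ s p.1 p.2) ∂(μ.prod μ) ≤
      (K / ENNReal.ofReal δ ^ s) * ∫⁻ x, a x ∂μ := by
    rw [lintegral_prod_symm' _ h₂, ← lintegral_const_mul _ ha]
    refine lintegral_mono fun y => ?_
    dsimp only
    have hky : Measurable fun x => ENNReal.ofReal |φ x - φ y| / weight μ s x y :=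
      hkm.comp measurable_prodMk_right
    rw [lintegral_const_mul _ hky, mul_comm]
    gcongr
    refine hK y δ hφ.pos (fun x => ENNReal.ofReal |φ x - φ y|) (fun x => ?_) (fun x => ?_)
    · exact ENNReal.ofReal_le_one.2 (hφ.abs_sub_le_one x y)
    · exact ENNReal.ofReal_le_ofReal (hφ.abs_sub_le x y)
  simp_rw [mul_div_assoc, add_mul]
  rw [lintegral_add_left h₁, hswap, ← two_mul, mul_assoc]
  gcongr

/-- The test function is admissible. Its seminorm is finite because inside `Ω` its differences are
controlled by those of `u` and of the cutoff, and across the boundary of `Ω` by the cutoff alone. -/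
lemma memW₀_testFun (hΩ : MeasurableSet Ω) (hB : MeasurableSet B) (hBΩ : B ⊆ Ω) (hBfin : μ B < ∞)
    (hφ : IsCutoff φ B δ) (hh : 0 ≤ h) (hKtop : K ≠ ∞)
    (hK : HasKernelBound μ s K)
    (hu : Measurable u) (hfin : ∀ x ∈ Ω, u x ≠ ⊤ ∧ u x ≠ ⊥) (hsem : seminorm μ s Ω u < ∞) :
    MemW₀ μ s Ω (fun x => (testFun φ t h u x : EReal)) := by
  have hφm := hφ.continuous.measurable
  have hηm := measurable_testFun (t := t) (h := h) hφ hu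
  have hwm := measurable_weight (μ := μ) s
  have hum := measurable_absDiff hu
  have h1Ω : Measurable (Ω.indicator (1 : X → ℝ≥0∞)) := measurable_one.indicator hΩ
  have h1B : Measurable (B.indicator (1 : X → ℝ≥0∞)) := measurable_one.indicator hB
  refine ⟨⟨hηm.coe_real_ereal.aemeasurable, ENNReal.add_lt_top.2 ⟨?_, ?_⟩⟩,
    ae_of_all _ fun x hx => ?_⟩
  · rw [Measure.restrict_univ]
    have hle : ∀ x, EReal.abs (testFun φ t h u x : EReal) ≤
        B.indicator (fun _ => ENNReal.ofReal h) x := by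
      intro x
      by_cases hx : x ∈ B
      · rw [indicator_of_mem hx, EReal.abs_def, abs_of_nonneg (testFun_nonneg hφ.nonneg x)]
        refine ENNReal.ofReal_le_ofReal ((testFun_le hφ.nonneg hh x).trans ?_)
        exact mul_le_of_le_one_right hh (hφ.le_one x)
      · simp [testFun, hφ.eq_zero x hx]
    refine (lintegral_mono hle).trans_lt ?_
    rw [lintegral_indicator_const hB]
    exact ENNReal.mul_lt_top ENNReal.ofReal_lt_top hBfin
  · rw [seminorm, Measure.restrict_univ]
    simp only [absDiff_coe]
    have hDm : Measurable fun p : X × X => ENNReal.ofReal |testFun φ t h u p.1 -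
        testFun φ t h u p.2| / weight μ s p.1 p.2 := Measurable.div (by fun_prop) hwm
    have hFm : Measurable fun p : X × X => Ω.indicator 1 p.1 * Ω.indicator 1 p.2 *
        absDiff u p.1 p.2 / weight μ s p.1 p.2 :=
      (((h1Ω.comp measurable_fst).mul (h1Ω.comp measurable_snd)).mul hum).div hwm
    have hRm : Measurable fun p : X × X => (B.indicator 1 p.1 + B.indicator 1 p.2) *
        ENNReal.ofReal |φ p.1 - φ p.2| / weight μ s p.1 p.2 :=
      (((h1B.comp measurable_fst).add (h1B.comp measurable_snd)).mul (by fun_prop)).div hwm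
    rw [← lintegral_prod_symm' _ hDm]
    calc ∫⁻ p, ENNReal.ofReal |testFun φ t h u p.1 - testFun φ t h u p.2| /
          weight μ s p.1 p.2 ∂(μ.prod μ)
        ≤ ∫⁻ p, (Ω.indicator 1 p.1 * Ω.indicator 1 p.2 * absDiff u p.1 p.2 / weight μ s p.1 p.2 +
            ENNReal.ofReal h * ((B.indicator 1 p.1 + B.indicator 1 p.2) *
              ENNReal.ofReal |φ p.1 - φ p.2| / weight μ s p.1 p.2)) ∂(μ.prod μ) := by
          refine lintegral_mono fun p => ?_
          dsimp only
          rw [← mul_div_assoc, ENNReal.div_add_div_same]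
          gcongr
          exact abs_testFun_sub_le hφ.nonneg hφ.le_one hφ.eq_zero hBΩ hfin hh _ _
      _ = (∫⁻ p, Ω.indicator 1 p.1 * Ω.indicator 1 p.2 * absDiff u p.1 p.2 /
            weight μ s p.1 p.2 ∂(μ.prod μ)) + ENNReal.ofReal h *
            ∫⁻ p, (B.indicator 1 p.1 + B.indicator 1 p.2) *
              ENNReal.ofReal |φ p.1 - φ p.2| / weight μ s p.1 p.2 ∂(μ.prod μ) := by
          rw [lintegral_add_left hFm, lintegral_const_mul _ hRm]
      _ < ∞ := by
          refine ENNReal.add_lt_top.2 ⟨?_, ENNReal.mul_lt_top ENNReal.ofReal_lt_top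
            ((lintegral_cutoff_le hφ hK h1B).trans_lt ?_)⟩
          · rw [lintegral_prod_symm' _ hFm]
            refine lt_of_le_of_lt (le_of_eq ?_) hsem
            rw [seminorm, ← lintegral_indicator hΩ]
            refine lintegral_congr fun y => ?_
            by_cases hy : y ∈ Ω
            · rw [indicator_of_mem hy, ← lintegral_indicator hΩ]
              refine lintegral_congr fun x => ?_
              by_cases hx : x ∈ Ω <;> simp [hx, hy]
            · simp [hy]
          · rw [lintegral_indicator_one hB]
            refine ENNReal.mul_lt_top (ENNReal.mul_lt_top (by simp) ?_) hBfin
            refine ENNReal.div_lt_top hKtop ?_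
            exact (ENNReal.rpow_pos (ENNReal.ofReal_pos.2 hφ.pos) ENNReal.ofReal_ne_top).ne'
  · simp [testFun, hφ.eq_zero x fun hxB => hx (hBΩ hxB)]

/-- The Caccioppoli inequality: the energy of the test function is controlled by the measure of
the sublevel set on the support of the cutoff. -/
lemma caccioppoli (hΩ : MeasurableSet Ω) (hB : MeasurableSet B) (hBΩ : B ⊆ Ω) (hBfin : μ B < ∞)
    (hφ : IsCutoff φ B δ) (hh : 0 ≤ h) (hKtop : K ≠ ∞)
    (hK : HasKernelBound μ s K)
    (hu : Measurable u) (hfin : ∀ x ∈ Ω, u x ≠ ⊤ ∧ u x ≠ ⊥) (hsup : IsSuperminimizer μ s Ω u) :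
    ∫⁻ p, ENNReal.ofReal |testFun φ t h u p.1 - testFun φ t h u p.2| / weight μ s p.1 p.2
        ∂energyMeasure μ Ω ≤
      8 * (ENNReal.ofReal h * (K / ENNReal.ofReal δ ^ s * μ {z | z ∈ B ∧ u z < t})) := by
  have hφm := hφ.continuous.measurable
  have hηm := measurable_testFun (t := t) (h := h) hφ hu
  have hwm := measurable_weight (μ := μ) s
  have hW := memW₀_testFun (t := t) hΩ hB hBΩ hBfin hφ hh hKtop hK hu hfin hsup.memHomogW.2
  have hfin' : ∀ x, (u x ≠ ⊤ ∧ u x ≠ ⊥) ∨ φ x = 0 := fun x => by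
    by_cases hx : x ∈ Ω
    · exact Or.inl (hfin x hx)
    · exact Or.inr (hφ.eq_zero x fun hxB => hx (hBΩ hxB))
  set η := testFun φ t h u with hη
  have hvm : Measurable fun x => u x + (η x : EReal) := hu.add hηm.coe_real_ereal
  have hDm : Measurable fun p : X × X => ENNReal.ofReal |η p.1 - η p.2| / weight μ s p.1 p.2 :=
    Measurable.div (by fun_prop) hwm
  have hPm : Measurable fun p : X × X =>
      (absDiff u p.1 p.2 - absDiff (fun x => u x + (η x : EReal)) p.1 p.2) /
        weight μ s p.1 p.2 :=
    ((measurable_absDiff hu).sub (measurable_absDiff hvm)).div hwm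
  set A := {z | z ∈ B ∧ u z < t} with hA
  have hAm : MeasurableSet A := hB.inter (hu measurableSet_Iio)
  have h1A : Measurable (A.indicator (1 : X → ℝ≥0∞)) :=
    measurable_one.indicator hAm
  have hRm : Measurable fun p : X × X => (A.indicator 1 p.1 + A.indicator 1 p.2) *
      ENNReal.ofReal |φ p.1 - φ p.2| / weight μ s p.1 p.2 :=
    (((h1A.comp measurable_fst).add (h1A.comp measurable_snd)).mul (by fun_prop)).div hwm
  have hNtop : energyPos μ s Ω (fun x => u x + (η x : EReal)) u ≠ ∞ := by
    rw [energyPos_eq hvm hu]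
    have hle : ∀ p : X × X, (absDiff (fun x => u x + (η x : EReal)) p.1 p.2 -
        absDiff u p.1 p.2) / weight μ s p.1 p.2 ≤
          ENNReal.ofReal |η p.1 - η p.2| / weight μ s p.1 p.2 := fun p =>
      ENNReal.div_le_div_right (absDiff_add_tsub_le _ _) _
    refine ne_top_of_le_ne_top ?_
      ((lintegral_mono hle).trans (lintegral_energyMeasure_le hΩ hDm))
    refine (ENNReal.mul_lt_top (by simp) ?_).ne
    have hsem := (ENNReal.add_lt_top.1 hW.1.2).2
    rw [seminorm, Measure.restrict_univ] at hsem
    simp only [absDiff_coe] at hsem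
    rwa [lintegral_prod_symm' _ hDm]
  have hmin : energyPos μ s Ω u (fun x => u x + (η x : EReal)) ≤
      energyPos μ s Ω (fun x => u x + (η x : EReal)) u := by
    have hle := hsup.energyDiff_le (fun x => (η x : EReal)) hW
      fun x => EReal.coe_nonneg.2 (testFun_nonneg hφ.nonneg x)
    rw [energyDiff, EReal.sub_nonpos] at hle
    exact EReal.coe_ennreal_le_coe_ennreal_iff.1 hle
  have hsum : (∫⁻ p, ENNReal.ofReal |η p.1 - η p.2| / weight μ s p.1 p.2 ∂energyMeasure μ Ω) +
      energyPos μ s Ω (fun x => u x + (η x : EReal)) u ≤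
      energyPos μ s Ω u (fun x => u x + (η x : EReal)) +
        ∫⁻ p, ENNReal.ofReal (2 * h) * ((A.indicator 1 p.1 + A.indicator 1 p.2) *
          ENNReal.ofReal |φ p.1 - φ p.2| / weight μ s p.1 p.2) ∂energyMeasure μ Ω := by
    rw [energyPos_eq hvm hu, energyPos_eq hu hvm, ← lintegral_add_left hDm,
      ← lintegral_add_left hPm]
    refine lintegral_mono fun p => ?_
    dsimp only
    rw [← mul_div_assoc, ENNReal.div_add_div_same, ENNReal.div_add_div_same]
    exact ENNReal.div_le_div_right
      (caccioppoli_pointwise hφ.nonneg hφ.le_one hφ.eq_zero hfin' hh _ _) _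
  have hD := (ENNReal.add_le_add_iff_right hNtop).1
    (hsum.trans ((add_le_add hmin le_rfl).trans_eq (add_comm _ _)))
  refine hD.trans ?_
  rw [lintegral_const_mul _ hRm]
  refine (mul_le_mul_right (lintegral_energyMeasure_le hΩ hRm) _).trans ?_
  refine (mul_le_mul_right (mul_le_mul_right (lintegral_cutoff_le hφ hK h1A) _) _).trans_eq ?_
  rw [lintegral_indicator_one hAm, ENNReal.ofReal_mul zero_le_two, ENNReal.ofReal_ofNat]
  ring

end

/-! ### Decay of the measure of sublevel sets -/

section

variable {X : Type*} [MetricSpace X] [MeasurableSpace X] {μ : Measure X}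
  {C : ℝ≥0} {s : ℝ} {K : ℝ≥0∞} {Ω : Set X} {u : X → EReal}

lemma IsDoublingWith.weight_le (hC : IsDoublingWith μ C) (hs : 0 ≤ s) {x y : X} {ρ : ℝ}
    (hρ : dist x y < ρ) : weight μ s x y ≤ C * μ (ball y ρ) * ENNReal.ofReal ρ ^ s := by
  have hρ0 : 0 < ρ := dist_nonneg.trans_lt hρ
  unfold weight
  gcongr
  · refine le_trans (measure_mono (union_subset ?_ ?_)) (hC y ρ hρ0).2.2
    · refine ball_subset_ball' ?_
      linarith
    · refine ball_subset_ball ?_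
      rw [dist_comm]
      linarith
  · rw [edist_dist]
    exact ENNReal.ofReal_le_ofReal hρ.le

variable [BorelSpace X]

/-- A fractional isoperimetric inequality: if the ball of radius `ρ` around each point of `A` is at
least half outside `A`, then a function that vanishes outside `A` is controlled by its energy at
scale `ρ`. No Poincaré inequality is involved: the nonlocal energy sees the values outside `A`
directly. -/
lemma lintegral_le_energy (hC : IsDoublingWith μ C) (hC0 : C ≠ 0) (hs : 0 < s) {A : Set X}
    (hA : MeasurableSet A) (hAΩ : A ⊆ Ω) {η : X → ℝ}
    (hη0 : ∀ x, 0 ≤ η x) (hηA : ∀ x, x ∉ A → η x = 0) {ρ : ℝ} (hρ : 0 < ρ)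
    (hball : ∀ y ∈ A, 2 * μ A ≤ μ (ball y ρ)) :
    ∫⁻ y, ENNReal.ofReal (η y) ∂μ ≤ 2 * C * ENNReal.ofReal ρ ^ s *
      ∫⁻ y in Ω, ∫⁻ x, ENNReal.ofReal |η x - η y| / weight μ s x y ∂μ ∂μ := by
  have hρs0 : ENNReal.ofReal ρ ^ s ≠ 0 :=
    (ENNReal.rpow_pos (ENNReal.ofReal_pos.2 hρ) ENNReal.ofReal_ne_top).ne'
  have hρst : ENNReal.ofReal ρ ^ s ≠ ∞ := ENNReal.rpow_ne_top_of_nonneg hs.le ENNReal.ofReal_ne_top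
  have hpt : ∀ y ∈ A, ENNReal.ofReal (η y) ≤ 2 * C * ENNReal.ofReal ρ ^ s *
      ∫⁻ x, ENNReal.ofReal |η x - η y| / weight μ s x y ∂μ := by
    intro y hy
    obtain ⟨hm0, hmt, -⟩ := hC y ρ hρ
    have hhalf : μ (ball y ρ) ≤ 2 * μ (ball y ρ \ A) := by
      have h₁ : μ (ball y ρ) ≤ μ A + μ (ball y ρ \ A) :=
        (measure_mono (by intro z hz; by_cases h : z ∈ A <;> simp [h, hz])).trans
          (measure_union_le A (ball y ρ \ A))
      have h₂ : μ (ball y ρ) + μ (ball y ρ) ≤ μ (ball y ρ) + 2 * μ (ball y ρ \ A) := by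
        calc μ (ball y ρ) + μ (ball y ρ) = 2 * μ (ball y ρ) := (two_mul _).symm
          _ ≤ 2 * (μ A + μ (ball y ρ \ A)) := by gcongr
          _ = 2 * μ A + 2 * μ (ball y ρ \ A) := mul_add _ _ _
          _ ≤ μ (ball y ρ) + 2 * μ (ball y ρ \ A) := by gcongr; exact hball y hy
      exact (ENNReal.add_le_add_iff_left hmt.ne).1 h₂
    set W : ℝ≥0∞ := C * μ (ball y ρ) * ENNReal.ofReal ρ ^ s with hW
    have hW0 : W ≠ 0 := mul_ne_zero (mul_ne_zero (by simpa using hC0) hm0.ne') hρs0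
    have hWt : W ≠ ∞ := ENNReal.mul_ne_top (ENNReal.mul_ne_top ENNReal.coe_ne_top hmt.ne) hρst
    have hinner : ENNReal.ofReal (η y) / W * μ (ball y ρ \ A) ≤
        ∫⁻ x, ENNReal.ofReal |η x - η y| / weight μ s x y ∂μ := by
      rw [← setLIntegral_const]
      refine le_trans (setLIntegral_mono' (measurableSet_ball.diff hA) fun x hx => ?_)
        (setLIntegral_le_lintegral (ball y ρ \ A) _)
      rw [hηA x hx.2, zero_sub, abs_neg, abs_of_nonneg (hη0 y)]
      exact ENNReal.div_le_div_left (hC.weight_le hs.le (mem_ball.1 hx.1)) _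
    calc ENNReal.ofReal (η y) = ENNReal.ofReal (η y) / W * W :=
          (ENNReal.div_mul_cancel hW0 hWt).symm
      _ ≤ ENNReal.ofReal (η y) / W *
          (C * (2 * μ (ball y ρ \ A)) * ENNReal.ofReal ρ ^ s) := by
          rw [hW]; gcongr
      _ = 2 * C * ENNReal.ofReal ρ ^ s * (ENNReal.ofReal (η y) / W * μ (ball y ρ \ A)) := by ring
      _ ≤ _ := by gcongr
  have hcst : 2 * (C : ℝ≥0∞) * ENNReal.ofReal ρ ^ s ≠ ∞ :=
    ENNReal.mul_ne_top (ENNReal.mul_ne_top (by simp) ENNReal.coe_ne_top) hρst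
  rw [← lintegral_const_mul' _ _ hcst]
  calc ∫⁻ y, ENNReal.ofReal (η y) ∂μ ≤ ∫⁻ y in A, ENNReal.ofReal (η y) ∂μ := by
        rw [← lintegral_indicator hA]
        refine lintegral_mono fun y => ?_
        by_cases hy : y ∈ A
        · simp [hy]
        · simp [hηA y hy]
    _ ≤ ∫⁻ y in A, 2 * C * ENNReal.ofReal ρ ^ s *
          ∫⁻ x, ENNReal.ofReal |η x - η y| / weight μ s x y ∂μ ∂μ := setLIntegral_mono' hA hpt
    _ ≤ _ := lintegral_mono_set hAΩ

variable [SFinite μ] [SecondCountableTopology X]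

/-- One step of the iteration: passing from the radius `r'` to `r` gains a power of
`ρ / (r' - r)`, provided that the sublevel set is small at scale `ρ`. -/
lemma measure_sublevel_le (hC : IsDoublingWith μ C) (hC0 : C ≠ 0) (hs : 0 < s) (hKtop : K ≠ ∞)
    (hK : HasKernelBound μ s K) (hΩ : MeasurableSet Ω) (hu : Measurable u)
    (hfin : ∀ x ∈ Ω, u x ≠ ⊤ ∧ u x ≠ ⊥) (hsup : IsSuperminimizer μ s Ω u) {x₀ : X} {r r' ρ t : ℝ}
    (hr0 : 0 < r) (hr : r < r') (hBΩ : ball x₀ r' ⊆ Ω) (hρ : 0 < ρ)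
    (hball : ∀ y ∈ ball x₀ r', 2 * μ {z | z ∈ ball x₀ r' ∧ u z < t} ≤ μ (ball y ρ)) :
    μ {z | z ∈ ball x₀ r ∧ u z < t} ≤
      16 * C * K * ENNReal.ofReal (ρ / (r' - r)) ^ s * μ {z | z ∈ ball x₀ r' ∧ u z < t} := by
  obtain ⟨φ, hφ, hφ1⟩ := exists_isCutoff x₀ hr
  have hBfin : μ (ball x₀ r') < ∞ := (hC x₀ r' (hr0.trans hr)).2.1
  set A := {z | z ∈ ball x₀ r' ∧ u z < t} with hA
  have hAm : MeasurableSet A := measurableSet_ball.inter (hu measurableSet_Iio)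
  have hfin' : ∀ x, (u x ≠ ⊤ ∧ u x ≠ ⊥) ∨ φ x = 0 := fun x => by
    by_cases hx : x ∈ Ω
    · exact Or.inl (hfin x hx)
    · exact Or.inr (hφ.eq_zero x fun hxB => hx (hBΩ hxB))
  have hδ : 0 < r' - r := hφ.pos
  set S : ℕ → Set X := fun n => {z | z ∈ ball x₀ r ∧ u z ≤ ((t - 1 / ((n : ℝ) + 1) : ℝ) : EReal)}
    with hS
  have hstep : ∀ n, μ (S n) ≤ 16 * C * K * ENNReal.ofReal (ρ / (r' - r)) ^ s * μ A := by
    intro n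
    set h : ℝ := 1 / ((n : ℝ) + 1) with hh
    have hpos : 0 < h := by positivity
    have hSm : MeasurableSet (S n) := measurableSet_ball.inter (hu measurableSet_Iic)
    have hηm : Measurable (testFun φ t h u) := measurable_testFun hφ hu
    have hlow : ∀ z ∈ S n, ENNReal.ofReal h ≤ ENNReal.ofReal (testFun φ t h u z) := by
      intro z hz
      refine ENNReal.ofReal_le_ofReal ?_
      have hzf := hfin z (hBΩ (ball_subset_ball hr.le hz.1))
      have hzt := hz.2
      rw [← EReal.coe_toReal hzf.1 hzf.2, EReal.coe_le_coe_iff] at hzt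
      rw [testFun, hφ1 z hz.1, one_mul]
      exact le_max_of_le_right (le_min (by linarith) le_rfl)
    have hcacc := caccioppoli (t := t) hΩ measurableSet_ball hBΩ hBfin hφ hpos.le hKtop hK hu hfin
      hsup
    have hiso := lintegral_le_energy hC hC0 hs hAm (fun z hz => hBΩ hz.1)
      (η := testFun φ t h u) (testFun_nonneg hφ.nonneg)
      (fun x hx => testFun_eq_zero hφ.eq_zero hfin' hx) hρ
      (fun y hy => hball y hy.1)
    have hDm : Measurable fun p : X × X => ENNReal.ofReal |testFun φ t h u p.1 -
        testFun φ t h u p.2| / weight μ s p.1 p.2 :=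
      Measurable.div (by fun_prop) (measurable_weight s)
    have hchain : ENNReal.ofReal h * μ (S n) ≤ ENNReal.ofReal h *
        (16 * C * K * ENNReal.ofReal (ρ / (r' - r)) ^ s * μ A) := by
      calc ENNReal.ofReal h * μ (S n) = ∫⁻ _ in S n, ENNReal.ofReal h ∂μ :=
            (setLIntegral_const _ _).symm
        _ ≤ ∫⁻ z in S n, ENNReal.ofReal (testFun φ t h u z) ∂μ := setLIntegral_mono' hSm hlow
        _ ≤ ∫⁻ z, ENNReal.ofReal (testFun φ t h u z) ∂μ := setLIntegral_le_lintegral _ _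
        _ ≤ _ := hiso
        _ ≤ 2 * C * ENNReal.ofReal ρ ^ s *
              (8 * (ENNReal.ofReal h * (K / ENNReal.ofReal (r' - r) ^ s * μ A))) := by
            gcongr
            exact (le_lintegral_energyMeasure hΩ hDm).trans hcacc
        _ = _ := by
            rw [ENNReal.ofReal_div_of_pos hδ, ENNReal.div_rpow_of_nonneg _ _ hs.le,
              div_eq_mul_inv, div_eq_mul_inv]
            ring
    exact (ENNReal.mul_le_mul_iff_right (ENNReal.ofReal_pos.2 hpos).ne'
      ENNReal.ofReal_ne_top).1 hchain
  have hmono : Monotone S := by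
    refine fun m n hmn z hz => ⟨hz.1, hz.2.trans (EReal.coe_le_coe_iff.2 ?_)⟩
    gcongr
  have hsub : {z | z ∈ ball x₀ r ∧ u z < t} ⊆ ⋃ n, S n := by
    rintro z ⟨hz, hzt⟩
    have hzf := hfin z (hBΩ (ball_subset_ball hr.le hz))
    rw [← EReal.coe_toReal hzf.1 hzf.2, EReal.coe_lt_coe_iff] at hzt
    obtain ⟨n, hn⟩ := exists_nat_one_div_lt (sub_pos.2 hzt)
    refine mem_iUnion.2 ⟨n, hz, ?_⟩
    rw [← EReal.coe_toReal hzf.1 hzf.2, EReal.coe_le_coe_iff]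
    linarith
  refine (measure_mono hsub).trans ?_
  rw [hmono.measure_iUnion]
  exact iSup_le hstep

/-- If a superminimizer is at least `t` on most of a ball, then it is at least `t` almost
everywhere on the concentric ball of half the radius. -/
lemma exists_measure_sublevel_eq_zero (hC : IsDoublingWith μ C) (hC2 : 2 ≤ C) (hs : 0 < s)
    (hKtop : K ≠ ∞) (hK : HasKernelBound μ s K) :
    ∃ ε : ℝ≥0∞, 0 < ε ∧ ∀ (Ω : Set X) (u : X → EReal), MeasurableSet Ω → Measurable u →
      (∀ x ∈ Ω, u x ≠ ⊤ ∧ u x ≠ ⊥) → IsSuperminimizer μ s Ω u → ∀ (x₀ : X) (R t : ℝ), 0 < R →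
        ball x₀ R ⊆ Ω → μ {z | z ∈ ball x₀ R ∧ u z < t} ≤ ε * μ (ball x₀ R) →
          μ {z | z ∈ ball x₀ (R / 2) ∧ u z < t} = 0 := by
  have hC0 : C ≠ 0 := (two_pos.trans_le hC2).ne'
  have hCe0 : (C : ℝ≥0∞) ≠ 0 := by simpa using hC0
  -- `N` fixes the ratio `ρ / δ = 2⁻ᴺ` for which one step of the iteration gains a factor `C⁻¹`.
  obtain ⟨N, hN⟩ : ∃ N : ℕ,
      (C : ℝ≥0∞) * (16 * C * K * ENNReal.ofReal ((2⁻¹ : ℝ) ^ N) ^ s) ≤ 1 := by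
    have hlim : Tendsto (fun N : ℕ => (C : ℝ≥0∞) * (16 * C * K) *
        (ENNReal.ofReal 2⁻¹ ^ s) ^ N) atTop (𝓝 ((C : ℝ≥0∞) * (16 * C * K) * 0)) := by
      refine ENNReal.Tendsto.const_mul (ENNReal.tendsto_pow_atTop_nhds_zero_of_lt_one ?_)
        (Or.inr ?_)
      · refine ENNReal.rpow_lt_one ?_ hs
        rw [ENNReal.ofReal_lt_one]
        norm_num
      · exact ENNReal.mul_ne_top ENNReal.coe_ne_top
          (ENNReal.mul_ne_top (ENNReal.mul_ne_top (by simp) ENNReal.coe_ne_top) hKtop)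
    rw [mul_zero] at hlim
    obtain ⟨N, hN⟩ := (hlim.eventually (ge_mem_nhds zero_lt_one)).exists
    refine ⟨N, le_trans (le_of_eq ?_) hN⟩
    rw [ENNReal.ofReal_pow (by norm_num), ← ENNReal.rpow_natCast, ← ENNReal.rpow_mul,
      ← ENNReal.rpow_natCast, ← ENNReal.rpow_mul, mul_comm (N : ℝ)]
    ring
  refine ⟨(2 * (C : ℝ≥0∞) ^ (N + 3))⁻¹, ?_, ?_⟩
  · exact ENNReal.inv_pos.2 (ENNReal.mul_ne_top (by simp) (ENNReal.pow_ne_top ENNReal.coe_ne_top))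
  intro Ω u hΩ hu hfin hsup x₀ R t hR hBΩ hsmall
  set r : ℕ → ℝ := fun k => R / 2 * (1 + 2⁻¹ ^ k) with hr
  set m : ℕ → ℝ≥0∞ := fun k => μ {z | z ∈ ball x₀ (r k) ∧ u z < t} with hm
  have hr0 : r 0 = R := by simp only [hr, pow_zero]; ring
  have hrpos : ∀ k, 0 < r k := fun k => by positivity
  have hrR : ∀ k, r k ≤ R := fun k => by
    have h1 : (2⁻¹ : ℝ) ^ k ≤ 1 := pow_le_one₀ (by norm_num) (by norm_num)
    simp only [hr]
    nlinarith
  have hsmall' : 2 * (C : ℝ≥0∞) ^ (N + 3) * m 0 ≤ μ (ball x₀ R) := by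
    have hne0 : 2 * (C : ℝ≥0∞) ^ (N + 3) ≠ 0 := mul_ne_zero (by simp) (pow_ne_zero _ hCe0)
    have hnet : 2 * (C : ℝ≥0∞) ^ (N + 3) ≠ ∞ :=
      ENNReal.mul_ne_top (by simp) (ENNReal.pow_ne_top ENNReal.coe_ne_top)
    simp only [hm, hr0]
    refine (mul_le_mul_right hsmall _).trans_eq ?_
    rw [← mul_assoc, ENNReal.mul_inv_cancel hne0 hnet, one_mul]
  have hdecay : ∀ k, (C : ℝ≥0∞) ^ k * m k ≤ m 0 := by
    intro k
    induction k with
    | zero => simp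
    | succ k ih =>
      set ρ : ℝ := R / 4 * 2⁻¹ ^ k * 2⁻¹ ^ N with hρ
      have hρpos : 0 < ρ := by positivity
      have hdiff : r k - r (k + 1) = R / 4 * 2⁻¹ ^ k := by simp only [hr, pow_succ]; ring
      have hlt : r (k + 1) < r k := by
        have : 0 < R / 4 * 2⁻¹ ^ k := by positivity
        linarith
      have hball : ∀ y ∈ ball x₀ (r k), 2 * m k ≤ μ (ball y ρ) := by
        intro y hy
        have hsub : ball x₀ R ⊆ ball y (2 ^ (k + N + 3) * ρ) := by
          have he : (2 : ℝ) ^ (k + N + 3) * ρ = 2 * R := by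
            have h1 : (2 : ℝ) ^ k * 2⁻¹ ^ k = 1 := by rw [← mul_pow]; norm_num
            have h2 : (2 : ℝ) ^ N * 2⁻¹ ^ N = 1 := by rw [← mul_pow]; norm_num
            calc (2 : ℝ) ^ (k + N + 3) * ρ =
                  2 * R * ((2 : ℝ) ^ k * 2⁻¹ ^ k) * ((2 : ℝ) ^ N * 2⁻¹ ^ N) := by
                  rw [hρ, pow_add, pow_add]; ring
              _ = 2 * R := by rw [h1, h2]; ring
          rw [he]
          refine ball_subset_ball' ?_
          have := (mem_ball'.1 hy).le.trans (hrR k)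
          linarith
        have hlower := (measure_mono hsub).trans
          (hC.measure_ball_two_pow_mul_le y hρpos (k + N + 3))
        have hchain : (C : ℝ≥0∞) ^ (k + N + 3) * (2 * m k) ≤
            (C : ℝ≥0∞) ^ (k + N + 3) * μ (ball y ρ) := by
          calc (C : ℝ≥0∞) ^ (k + N + 3) * (2 * m k) =
                2 * (C : ℝ≥0∞) ^ (N + 3) * ((C : ℝ≥0∞) ^ k * m k) := by ring
            _ ≤ 2 * (C : ℝ≥0∞) ^ (N + 3) * m 0 := by gcongr
            _ ≤ μ (ball x₀ R) := hsmall'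
            _ ≤ _ := hlower
        exact (ENNReal.mul_le_mul_iff_right (pow_ne_zero _ hCe0)
          (ENNReal.pow_ne_top ENNReal.coe_ne_top)).1 hchain
      have hstep := measure_sublevel_le hC hC0 hs hKtop hK hΩ hu hfin hsup (hrpos (k + 1)) hlt
        ((ball_subset_ball (hrR k)).trans hBΩ) hρpos hball
      have hratio : ρ / (r k - r (k + 1)) = 2⁻¹ ^ N := by
        rw [hdiff, hρ, mul_div_cancel_left₀ _ (by positivity)]
      rw [hratio] at hstep
      calc (C : ℝ≥0∞) ^ (k + 1) * m (k + 1) ≤ (C : ℝ≥0∞) ^ (k + 1) *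
            (16 * C * K * ENNReal.ofReal ((2⁻¹ : ℝ) ^ N) ^ s * m k) := by gcongr
        _ = (C : ℝ≥0∞) * (16 * C * K * ENNReal.ofReal ((2⁻¹ : ℝ) ^ N) ^ s) *
            ((C : ℝ≥0∞) ^ k * m k) := by ring
        _ ≤ 1 * m 0 := by gcongr
        _ = m 0 := one_mul _
  have hm0 : m 0 ≠ ∞ := by
    refine ((measure_mono fun z hz => ?_).trans_lt (hC x₀ R hR).2.1).ne
    rw [hr0] at hz
    exact hz.1
  have hlim : Tendsto (fun k : ℕ => m 0 * (2⁻¹ : ℝ≥0∞) ^ k) atTop (𝓝 (m 0 * 0)) :=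
    ENNReal.Tendsto.const_mul
      (ENNReal.tendsto_pow_atTop_nhds_zero_of_lt_one (by norm_num)) (Or.inr hm0)
  rw [mul_zero] at hlim
  refine le_antisymm (ge_of_tendsto' hlim fun k => ?_) zero_le
  have hmk : μ {z | z ∈ ball x₀ (R / 2) ∧ u z < t} ≤ m k := by
    refine measure_mono fun z hz => ⟨ball_subset_ball ?_ hz.1, hz.2⟩
    have : 0 ≤ R / 2 * 2⁻¹ ^ k := by positivity
    simp only [hr]
    linarith
  refine hmk.trans ?_
  rw [← ENNReal.inv_pow, ← div_eq_mul_inv, ENNReal.le_div_iff_mul_le (by simp) (by simp), mul_comm]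
  refine le_trans ?_ (hdecay k)
  gcongr
  exact_mod_cast hC2

end

/-! ### Representatives and reflection -/

section

variable {X : Type*} {u v : X → EReal}

/-- `absDiff` is invariant under a change of sign, also where the sign of an infinite value gets
lost in the process: all infinite values contribute `∞`. -/
lemma absDiff_eq_of_neg (huv : ∀ z, v z = -u z ∨ ((v z = ⊤ ∨ v z = ⊥) ∧ (u z = ⊤ ∨ u z = ⊥)))
    (x y : X) : absDiff v x y = absDiff u x y := by
  have hinf : ∀ z, (u z = ⊤ ∨ u z = ⊥) → (v z = ⊤ ∨ v z = ⊥) := by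
    intro z hz
    rcases huv z with h | h
    · rw [h, EReal.neg_eq_top_iff, EReal.neg_eq_bot_iff]; exact hz.symm
    · exact h.1
  by_cases hx : u x = ⊤ ∨ u x = ⊥
  · rw [absDiff_eq_top hx, absDiff_eq_top (hinf x hx)]
  by_cases hy : u y = ⊤ ∨ u y = ⊥
  · rw [absDiff_comm v, absDiff_comm u, absDiff_eq_top hy, absDiff_eq_top (hinf y hy)]
  have hvx : v x = -u x := (huv x).resolve_right fun h => hx h.2
  have hvy : v y = -u y := (huv y).resolve_right fun h => hy h.2
  rw [not_or] at hx hy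
  rw [absDiff, absDiff, hvx, hvy, ← EReal.coe_toReal hx.1 hx.2, ← EReal.coe_toReal hy.1 hy.2,
    ← EReal.coe_neg, ← EReal.coe_neg, ← EReal.coe_sub, ← EReal.coe_sub, EReal.abs_def,
    EReal.abs_def, ← abs_neg]
  congr 2
  ring

/-- Reflection commutes with the sum of extended reals, except for the conventions in `∞ - ∞`,
where both sides are infinite. -/
lemma neg_add_eq_neg_or_infinite (a b : EReal) :
    -a + b = -(a + -b) ∨ ((-a + b = ⊤ ∨ -a + b = ⊥) ∧ (a + -b = ⊤ ∨ a + -b = ⊥)) := by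
  induction a with
  | coe a =>
    induction b with
    | coe b => left; norm_cast; ring
    | _ => simp
  | _ => induction b <;> simp

variable [MetricSpace X] [MeasurableSpace X] {μ : Measure X} {s : ℝ} {Ω : Set X}

lemma tendsto_density_zero_of_null {p : X → Prop} {x₀ x : X} {R : ℝ} (hx : x ∈ ball x₀ R)
    (hnull : μ {z | z ∈ ball x₀ R ∧ p z} = 0) :
    Tendsto (fun r : ℝ => μ {y | y ∈ ball x r ∧ p y} / μ (ball x r)) (𝓝[>] 0) (𝓝 0) := by
  obtain ⟨δ, hδ, hsub⟩ := Metric.isOpen_iff.1 isOpen_ball x hx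
  refine Tendsto.congr' ?_ tendsto_const_nhds
  filter_upwards [Ioo_mem_nhdsGT hδ] with r hr
  have hz : μ {y | y ∈ ball x r ∧ p y} = 0 :=
    measure_mono_null (t := {z | z ∈ ball x₀ R ∧ p z})
      (fun y hy => ⟨hsub (ball_subset_ball hr.2.le hy.1), hy.2⟩) hnull
  rw [hz, ENNReal.zero_div]

lemma seminorm_eq_of_absDiff_eq (h : ∀ x y, absDiff v x y = absDiff u x y) :
    seminorm μ s Ω v = seminorm μ s Ω u := by
  simp only [seminorm, h]

lemma IsSubminimizer.neg (hsub : IsSubminimizer μ s Ω u) :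
    IsSuperminimizer μ s Ω (fun x => -u x) := by
  have habs : ∀ (w : X → EReal) (x y : X), absDiff (fun z => -w z) x y = absDiff w x y :=
    fun w => absDiff_eq_of_neg fun z => Or.inl rfl
  refine ⟨hsub.aemeasurable.neg, ⟨hsub.memHomogW.1.neg, ?_⟩, fun η hη hη0 => ?_⟩
  · rw [seminorm_eq_of_absDiff_eq (habs u)]
    exact hsub.memHomogW.2
  have hη' : MemW₀ μ s Ω (fun x => -η x) := by
    refine ⟨⟨hη.1.1.neg, ?_⟩, hη.2.mono fun x hx hxΩ => by simp [hx hxΩ]⟩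
    rw [seminorm_eq_of_absDiff_eq (habs η)]
    simpa only [EReal.abs_neg] using hη.1.2
  have hle := hsub.energyDiff_le _ hη' fun x => by simpa using EReal.neg_le_neg_iff.2 (hη0 x)
  have hsum : ∀ x y, absDiff (fun z => -u z + η z) x y = absDiff (fun z => u z + -η z) x y :=
    absDiff_eq_of_neg fun z => neg_add_eq_neg_or_infinite _ _
  simpa only [energyDiff, energyPos, habs, hsum] using hle

lemma energyPos_congr_ae {u' v' : X → EReal} (hu : u =ᵐ[μ] u') (hv : v =ᵐ[μ] v') :
    energyPos μ s Ω u v = energyPos μ s Ω u' v' := by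
  have hinner : ∀ (S : Set X) (y : X), u y = u' y → v y = v' y →
      ∫⁻ x in S, (absDiff u x y - absDiff v x y) / weight μ s x y ∂μ =
        ∫⁻ x in S, (absDiff u' x y - absDiff v' x y) / weight μ s x y ∂μ := by
    intro S y hy hy'
    refine lintegral_congr_ae (ae_restrict_of_ae ?_)
    filter_upwards [hu, hv] with x hx hx'
    simp only [absDiff, hx, hx', hy, hy']
  have houter : ∀ S : Set X,
      ∫⁻ y in Ω, ∫⁻ x in S, (absDiff u x y - absDiff v x y) / weight μ s x y ∂μ ∂μ =
        ∫⁻ y in Ω, ∫⁻ x in S, (absDiff u' x y - absDiff v' x y) / weight μ s x y ∂μ ∂μ := by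
    intro S
    refine lintegral_congr_ae (ae_restrict_of_ae ?_)
    filter_upwards [hu, hv] with y hy hy'
    exact hinner S y hy hy'
  rw [energyPos, energyPos, houter, houter]

lemma seminorm_congr_ae (h : u =ᵐ[μ] v) : seminorm μ s Ω u = seminorm μ s Ω v := by
  refine lintegral_congr_ae (ae_restrict_of_ae ?_)
  filter_upwards [h] with y hy
  refine lintegral_congr_ae (ae_restrict_of_ae ?_)
  filter_upwards [h] with x hx
  simp only [absDiff, hx, hy]

lemma IsSuperminimizer.congr_ae (hsup : IsSuperminimizer μ s Ω u) (h : u =ᵐ[μ] v) :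
    IsSuperminimizer μ s Ω v := by
  refine ⟨hsup.aemeasurable.congr h,
    ⟨hsup.memHomogW.1.congr (ae_restrict_of_ae h), ?_⟩, fun η hη hη0 => ?_⟩
  · rw [← seminorm_congr_ae h]
    exact hsup.memHomogW.2
  · have hadd : (fun x => u x + η x) =ᵐ[μ] fun x => v x + η x := h.mono fun x hx => by
      simp only [hx]
    rw [energyDiff, ← energyPos_congr_ae h hadd, ← energyPos_congr_ae hadd h]
    exact hsup.energyDiff_le η hη hη0

lemma IsDoublingWith.weight_ne_top {C : ℝ≥0} (hC : IsDoublingWith μ C) (hs : 0 ≤ s) (x y : X) :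
    weight μ s x y ≠ ∞ := by
  refine ne_top_of_le_ne_top ?_ (hC.weight_le hs (lt_add_one (dist x y)))
  exact ENNReal.mul_ne_top (ENNReal.mul_ne_top ENNReal.coe_ne_top
    (hC y _ (by positivity)).2.1.ne) (ENNReal.rpow_ne_top_of_nonneg hs ENNReal.ofReal_ne_top)

variable [BorelSpace X] [SFinite μ] [SecondCountableTopology X] {C : ℝ≥0}

/-- A function with finite seminorm is finite almost everywhere: an infinite value makes the inner
integral infinite. -/
lemma ae_finite_of_seminorm_lt_top (hC : IsDoublingWith μ C) (hs : 0 ≤ s) (hΩ : MeasurableSet Ω)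
    (hΩ0 : μ Ω ≠ 0) (hu : Measurable u) (hsem : seminorm μ s Ω u < ∞) :
    ∀ᵐ y ∂μ, y ∈ Ω → u y ≠ ⊤ ∧ u y ≠ ⊥ := by
  have hG : Measurable fun p : X × X => absDiff u p.1 p.2 / weight μ s p.1 p.2 :=
    (measurable_absDiff hu).div (measurable_weight s)
  have hae := ae_lt_top (μ := μ.restrict Ω) (hG.lintegral_prod_left' (μ := μ.restrict Ω)) hsem.ne
  rw [ae_restrict_iff' hΩ] at hae
  filter_upwards [hae] with y hy hyΩ
  by_contra hinf
  have hinf' : u y = ⊤ ∨ u y = ⊥ := by tauto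
  refine (hy hyΩ).ne ?_
  have hall : ∀ x, absDiff u x y / weight μ s x y = ∞ := fun x => by
    rw [absDiff_comm, absDiff_eq_top hinf', ENNReal.top_div_of_ne_top (hC.weight_ne_top hs x y)]
  simp only [hall, lintegral_const, Measure.restrict_apply_univ]
  exact ENNReal.top_mul hΩ0

lemma IsSuperminimizer.exists_measurable_finite (hC : IsDoublingWith μ C) (hs : 0 ≤ s)
    (hΩ : MeasurableSet Ω) (hΩ0 : μ Ω ≠ 0) (hsup : IsSuperminimizer μ s Ω u) :
    ∃ v : X → EReal, Measurable v ∧ (∀ x ∈ Ω, v x ≠ ⊤ ∧ v x ≠ ⊥) ∧ u =ᵐ[μ] v ∧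
      IsSuperminimizer μ s Ω v := by
  obtain ⟨w, hw, huw⟩ := hsup.aemeasurable
  have hwfin := ae_finite_of_seminorm_lt_top hC hs hΩ hΩ0 hw
    (hsup.congr_ae huw).memHomogW.2
  set S : Set X := Ω ∩ w ⁻¹' {⊤, ⊥} with hS
  have hSm : MeasurableSet S := hΩ.inter (hw ((measurableSet_singleton _).insert _))
  classical
  have hwv : w =ᵐ[μ] S.piecewise 0 w := by
    filter_upwards [hwfin] with x hx
    by_cases hxS : x ∈ S
    · have h1 := hx hxS.1
      have h2 : w x = ⊤ ∨ w x = ⊥ := hxS.2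
      tauto
    · rw [piecewise_eq_of_notMem _ _ _ hxS]
  refine ⟨S.piecewise 0 w, Measurable.piecewise hSm measurable_const hw, fun x hx => ?_,
    huw.trans hwv, hsup.congr_ae (huw.trans hwv)⟩
  by_cases hxS : x ∈ S
  · rw [piecewise_eq_of_mem _ _ _ hxS]
    simp
  · rw [piecewise_eq_of_notMem _ _ _ hxS]
    have h2 : ¬ (w x = ⊤ ∨ w x = ⊥) := fun h => hxS ⟨hx, h⟩
    tauto

/-! ### Semicontinuity of the approximate limits -/

/-- At a point of zero density of the sublevel set `{u < t}`, the sublevel set is null in a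
neighbourhood. -/
lemma IsSuperminimizer.exists_null_sublevel (hμ : IsDoubling μ) (hs0 : 0 < s) (hs1 : s < 1)
    (hΩ : IsOpen Ω) (hsup : IsSuperminimizer μ s Ω u) {x₀ : X} (hx₀ : x₀ ∈ Ω) {t : ℝ}
    (ht : Tendsto (fun r : ℝ => μ {y | y ∈ ball x₀ r ∧ u y < t} / μ (ball x₀ r))
      (𝓝[>] 0) (𝓝 0)) :
    ∃ R : ℝ, 0 < R ∧ ball x₀ R ⊆ Ω ∧ μ {z | z ∈ ball x₀ R ∧ u z < t} = 0 := by
  obtain ⟨C, hC2, hC⟩ := hμ.exists_two_le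
  obtain ⟨K, hKtop, hK⟩ := hC.exists_hasKernelBound hs0 hs1
  obtain ⟨ε, hε, hmain⟩ := exists_measure_sublevel_eq_zero hC hC2 hs0 hKtop hK
  obtain ⟨R₀, hR₀, hR₀Ω⟩ := Metric.isOpen_iff.1 hΩ x₀ hx₀
  have hΩ0 : μ Ω ≠ 0 := ((hC x₀ R₀ hR₀).1.trans_le (measure_mono hR₀Ω)).ne'
  obtain ⟨v, hv, hvfin, huv, hvsup⟩ :=
    hsup.exists_measurable_finite hC hs0.le hΩ.measurableSet hΩ0
  have hset : ∀ r : ℝ, μ {z | z ∈ ball x₀ r ∧ v z < t} = μ {z | z ∈ ball x₀ r ∧ u z < t} := by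
    intro r
    refine measure_congr ?_
    filter_upwards [huv] with z hz
    change (z ∈ ball x₀ r ∧ v z < t) = (z ∈ ball x₀ r ∧ u z < t)
    rw [hz]
  have hev : ∀ᶠ r : ℝ in 𝓝[>] 0, 0 < r ∧ r < R₀ ∧
      μ {y | y ∈ ball x₀ r ∧ u y < t} / μ (ball x₀ r) ≤ ε := by
    filter_upwards [Ioo_mem_nhdsGT hR₀, ht.eventually (ge_mem_nhds hε)] with r hr hr'
    exact ⟨hr.1, hr.2, hr'⟩
  obtain ⟨R, hR, hRR₀, hle⟩ := hev.exists
  obtain ⟨hm0, hmt, -⟩ := hC x₀ R hR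
  have hRΩ : ball x₀ R ⊆ Ω := (ball_subset_ball hRR₀.le).trans hR₀Ω
  refine ⟨R / 2, half_pos hR, (ball_subset_ball (half_le_self hR.le)).trans hRΩ, ?_⟩
  rw [← hset]
  refine hmain Ω v hΩ.measurableSet hv hvfin hvsup x₀ R t hR hRΩ ?_
  rw [hset]
  exact (ENNReal.div_le_iff hm0.ne' hmt.ne).1 hle

theorem IsSuperminimizer.lowerSemicontinuousOn (hμ : IsDoubling μ) (hs0 : 0 < s) (hs1 : s < 1)
    (hΩ : IsOpen Ω) (hsup : IsSuperminimizer μ s Ω u) :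
    LowerSemicontinuousOn (lowerApproxLimit μ u) Ω := by
  intro x₀ hx₀ a ha
  obtain ⟨_, ⟨t, ht, rfl⟩, hat⟩ := lt_sSup_iff.1 ha
  obtain ⟨R, hR, -, hnull⟩ := hsup.exists_null_sublevel hμ hs0 hs1 hΩ hx₀ ht
  filter_upwards [mem_nhdsWithin_of_mem_nhds (ball_mem_nhds x₀ hR)] with x hx
  exact hat.trans_le (le_sSup ⟨t, tendsto_density_zero_of_null hx hnull, rfl⟩)

theorem IsSubminimizer.upperSemicontinuousOn (hμ : IsDoubling μ) (hs0 : 0 < s) (hs1 : s < 1)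
    (hΩ : IsOpen Ω) (hsub : IsSubminimizer μ s Ω u) :
    UpperSemicontinuousOn (upperApproxLimit μ u) Ω := by
  intro x₀ hx₀ a ha
  obtain ⟨_, ⟨t, ht, rfl⟩, hta⟩ := sInf_lt_iff.1 ha
  have hneg : ∀ z, -u z < ((-t : ℝ) : EReal) ↔ (t : EReal) < u z := fun z => by
    rw [EReal.coe_neg, EReal.neg_lt_neg_iff]
  obtain ⟨R, hR, -, hnull⟩ := hsub.neg.exists_null_sublevel (t := -t) hμ hs0 hs1 hΩ hx₀
    (by simpa only [hneg, mem_ofPred_eq] using ht)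
  simp only [hneg] at hnull
  filter_upwards [mem_nhdsWithin_of_mem_nhds (ball_mem_nhds x₀ hR)] with x hx
  have hle : upperApproxLimit μ u x ≤ t := sInf_le ⟨t, tendsto_density_zero_of_null hx hnull, rfl⟩
  exact hle.trans_lt hta

end

end NonlocalMin

end

theorem corollary1p2 {X : Type*} [MetricSpace X] [CompleteSpace X] [ConnectedSpace X]
    [TopologicalSpace.SeparableSpace X] [MeasurableSpace X] [BorelSpace X]
    (μ : Measure X) (hμ : NonlocalMin.IsDoubling μ)
    (s : ℝ) (hs0 : 0 < s) (hs1 : s < 1)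
    (Ω : Set X) (hΩ : IsOpen Ω) (hΩne : Ω.Nonempty) :
    (∀ u : X → EReal, NonlocalMin.IsSuperminimizer μ s Ω u →
      LowerSemicontinuousOn (NonlocalMin.lowerApproxLimit μ u) Ω) ∧
    (∀ u : X → EReal, NonlocalMin.IsSubminimizer μ s Ω u →
      UpperSemicontinuousOn (NonlocalMin.upperApproxLimit μ u) Ω) := by
  have : SecondCountableTopology X := UniformSpace.secondCountable_of_separable X
  obtain ⟨C, -, hC⟩ := hμ.exists_two_le
  have := hC.isLocallyFiniteMeasure
  exact ⟨fun u hu => hu.lowerSemicontinuousOn hμ hs0 hs1 hΩ,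
    fun u hu => hu.upperSemicontinuousOn hμ hs0 hs1 hΩ⟩
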